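/- **Setting.** Let $\mathcal X\subset\mathbb R$ be bounded and let $\mathbf X=\{X_i\}_{i\ge 1}$ be a stationary process with values in $\mathcal X$ that is $\Psi^*$-mixing: $\psi^*(g)\to1$ as $g\to\infty$, where $$\psi^*(g)=\sup\frac{P(\mathcal A\cap\mathcal B)}{P(\mathcal A)P(\mathcal B)},$$ the supremum being over all $j$ and all events $\mathcal A\in\sigma(X_i:i\le j)$, $\mathcal B\in\sigma(X_i:i\ge j+g)$ of positive probability. Write $X^l=(X_1,\dots,X_l)$. Logarithms are to base 2. For $b\in\mathbb N$ let $[x]_b=2^{-b}\lfloor 2^bx\rfloor$ (applied coordinatewise to vectors) and $\mathcal X_b=\{[x]_b:x\in\mathcal X\}$. For $k\ge0$ let $$w_{a^{k+1}}=\log\frac1{P([X_{k+1}]_b=a_{k+1}\mid[X^k]_b=a^k)}\in[0,\infty]\quad(a^{k+1}\in\mathcal X_b^{k+1}),$$ with $w_{a^{k+1}}=\infty$ if $P([X^{k+1}]_b=a^{k+1})=0$, and let $$\bar d_k=\limsup_{b\to\infty}\frac{H([X_{k+1}]_b\mid[X^k]_b)}{b}$$ be the upper information dimension of order $k$. For $u^n\in\mathbb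 R^n$ let $$\hat p^{(k+1)}(a^{k+1}|u^n)=\frac{|\{i:\ k+1\le i\le n,\ (u_{i-k},\dots,u_i)=a^{k+1}\}|}{n-k}$$ be the empirical distribution of order $k+1$. **Theorem.** Fix $k\ge0$, $r>1$, $\delta>0$ and $\sigma\ge0$. Assume that there is a constant $f_{k+1}>0$ such that $P(X^{k+1}\in\mathcal S)\ge f_{k+1}|\mathcal S|$ (Lebesgue measure) for every measurable $\mathcal S\subseteq\mathcal X^{k+1}$ with $P(X^{k+1}\in\mathcal S)>0$. For each $n$ let $$b=b_n=\lceil r\log\log n\rceil,\qquad m=m_n=\lceil 80\,n\,b\,(\bar d_k+\delta)\rceil,\qquad \mu=\tfrac1m,$$ and let $Y^m=AX^n+Z^m$, where $A\in\mathbb R^{m\times n}$ has i.i.d. $\mathcal N(0,1)$ entries, $Z^m$ has i.i.d. $\mathcal N(0,\sigma^2)$ entries, and $\mathbf X$, $A$, $Z^m$ are independent. Let $$\mathcal F_o=\Big\{u^n\in\mathcal X_b^n:\ \sum_{a^{k+1}\in\mathcal X_b^{k+1}}w_{a^{k+1}}\,\hat p^{(k+1)}(a^{k+1}|u^n)\le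 b(\bar d_k+\delta)\Big\}\qquad(\infty\cdot0=0),$$ and consider the projected gradient descent iterates $\hat X^n(0)=0$, $$S^n(t+1)=\hat X^n(t)+\mu A^T(Y^m-A\hat X^n(t)),\qquad \hat X^n(t+1)\in\operatorname*{arg\,min}_{u^n\in\mathcal F_o}\|u^n-S^n(t+1)\|,$$ with error vectors $E^n(t)=\hat X^n(t)-[X^n]_b$ (Euclidean norms). Then $\mathcal F_o$ is nonempty for all sufficiently large $n$, and, with probability tending to one as $n\to\infty$, for every choice of the minimizers and simultaneously for all $t=1,2,\dots$, $$\frac1{\sqrt n}\|E^n(t+1)\|\le\frac{0.9}{\sqrt n}\|E^n(t)\|+2\Big(2+\sqrt{\tfrac nm}\Big)^2 2^{-b}+\frac\sigma2\sqrt{\frac{b(\bar d_k+3\delta)}{m}} .$$ -/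

import Mathlib

open MeasureTheory ProbabilityTheory Filter Topology
open scoped NNReal ENNReal Matrix

noncomputable section

namespace QMAP

variable {Ω : Type*} [MeasurableSpace Ω]

/-- The `b`-bit quantization `[x]_b = ⌊x⌋ + ∑_{i=1}^b 2^{-i} a_i`, where `0.a₁a₂…` is the binary
expansion of `x - ⌊x⌋`: truncation after `b` binary digits, that is `⌊2^b x⌋ / 2^b`. -/
def quantize (b : ℕ) (x : ℝ) : ℝ := (⌊(2 : ℝ) ^ b * x⌋ : ℝ) / 2 ^ b

/-- The quantized alphabet `𝒳_b = {[x]_b : x ∈ 𝒳}`. -/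
def quantizedAlphabet (𝒳 : Set ℝ) (b : ℕ) : Set ℝ := quantize b '' 𝒳

/-- The process `X 0, X 1, X 2, …` is (strictly) stationary. -/
def IsStationary (P : Measure Ω) (X : ℕ → Ω → ℝ) : Prop :=
  P.map (fun ω (i : ℕ) => X (i + 1) ω) = P.map (fun ω (i : ℕ) => X i ω)

/-- The σ-field generated by `X 0, …, X j`. -/
abbrev pastSigma (X : ℕ → Ω → ℝ) (j : ℕ) : MeasurableSpace Ω :=
  ⨆ (i : ℕ) (_ : i ≤ j), MeasurableSpace.comap (X i) inferInstance

/-- The σ-field generated by `X j, X (j + 1), …`. -/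
abbrev futureSigma (X : ℕ → Ω → ℝ) (j : ℕ) : MeasurableSpace Ω :=
  ⨆ (i : ℕ) (_ : j ≤ i), MeasurableSpace.comap (X i) inferInstance

/-- The mixing coefficient `ψ*(g)`: the supremum of `P (S ∩ T) / (P S * P T)` over all `j` and all
events `S` of positive probability in the past up to time `j` and `T` of positive probability in
the future from time `j + g` on. -/
def psiStar (P : Measure Ω) (X : ℕ → Ω → ℝ) (g : ℕ) : ℝ≥0∞ :=
  ⨆ (j : ℕ) (S : Set Ω) (T : Set Ω) (_ : MeasurableSet[pastSigma X j] S)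
    (_ : MeasurableSet[futureSigma X (j + g)] T) (_ : 0 < P S) (_ : 0 < P T),
    P (S ∩ T) / (P S * P T)

/-- A `ψ*`-mixing process: stationary, with `ψ*(g) → 1` as `g → ∞`. -/
structure IsPsiStarMixing (P : Measure Ω) (X : ℕ → Ω → ℝ) : Prop where
  stationary : IsStationary P X
  tendsto_psiStar : Tendsto (psiStar P X) atTop (𝓝 1)

/-- `P ([X^l]_b = a^l)`. -/
def blockProb (P : Measure Ω) (X : ℕ → Ω → ℝ) (b : ℕ) {l : ℕ} (a : Fin l → ℝ) : ℝ≥0∞ :=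
  P {ω | ∀ i : Fin l, quantize b (X i ω) = a i}

/-- `P ([X_{k+1}]_b = a_{k+1} | [X^k]_b = a^k)` (equal to `0` if `P ([X^k]_b = a^k) = 0`). -/
def condProb (P : Measure Ω) (X : ℕ → Ω → ℝ) (k b : ℕ) (a : Fin (k + 1) → ℝ) : ℝ≥0∞ :=
  blockProb P X b a / blockProb P X b (Fin.init a)

/-- The weight `w_a = log (1 / P ([X_{k+1}]_b = a_{k+1} | [X^k]_b = a^k)) ∈ [0, ∞]`, logarithm in
base 2, with `log (1 / 0) = ∞`. -/
def weight (P : Measure Ω) (X : ℕ → Ω → ℝ) (k b : ℕ) (a : Fin (k + 1) → ℝ) : ℝ≥0∞ :=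
  if condProb P X k b a = 0 then ⊤
  else ENNReal.ofReal (Real.logb 2 (1 / (condProb P X k b a).toReal))

/-- The conditional entropy `H([X_{k+1}]_b | [X^k]_b)` in bits, with `0 * ∞ = 0`. -/
def condEntropy (P : Measure Ω) (X : ℕ → Ω → ℝ) (𝒳 : Set ℝ) (k b : ℕ) : ℝ≥0∞ :=
  ∑' a : {a : Fin (k + 1) → ℝ // ∀ i, a i ∈ quantizedAlphabet 𝒳 b},
    blockProb P X b a.1 * weight P X k b a.1

/-- The upper information dimension of order `k`,
`limsup_{b → ∞} H([X_{k+1}]_b | [X^k]_b) / b`. The limit superior is taken in `[0, ∞]`; it is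
finite for a process with values in a bounded set. -/
def upperInfoDim (P : Measure Ω) (X : ℕ → Ω → ℝ) (𝒳 : Set ℝ) (k : ℕ) : ℝ :=
  (limsup (fun b : ℕ => condEntropy P X 𝒳 k b / (b : ℝ≥0∞)) atTop).toReal

/-- The empirical distribution of order `k + 1` of `u ∈ ℝ^n` at `a ∈ ℝ^{k+1}`: the number of
windows of length `k + 1` of `u` that equal `a`, divided by `n - k`. -/
def empDist {n : ℕ} (k : ℕ) (u : EuclideanSpace ℝ (Fin n)) (a : Fin (k + 1) → ℝ) : ℝ≥0∞ :=
  ({i : Fin (n - k) | ∀ j : Fin (k + 1), u ⟨i + j, by omega⟩ = a j}.ncard : ℝ≥0∞) /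
    ((n - k : ℕ) : ℝ≥0∞)

/-- The complexity `∑_{a ∈ 𝒳_b^{k+1}} w_a p̂(a | u)`, with `∞ * 0 = 0`. -/
def cost (P : Measure Ω) (X : ℕ → Ω → ℝ) (𝒳 : Set ℝ) (k b : ℕ) {n : ℕ}
    (u : EuclideanSpace ℝ (Fin n)) : ℝ≥0∞ :=
  ∑' a : {a : Fin (k + 1) → ℝ // ∀ i, a i ∈ quantizedAlphabet 𝒳 b},
    weight P X k b a.1 * empDist k u a.1

/-- The set of `u ∈ 𝒳_b^n` of complexity at most `γ`. -/
def feasibleSet (P : Measure Ω) (X : ℕ → Ω → ℝ) (𝒳 : Set ℝ) (k b n : ℕ) (γ : ℝ) :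
    Set (EuclideanSpace ℝ (Fin n)) :=
  {u | (∀ i, u i ∈ quantizedAlphabet 𝒳 b) ∧ cost P X 𝒳 k b u ≤ ENNReal.ofReal γ}

/-- `x 0, x 1, …` is a run of projected gradient descent for the response vector `Y`, the design
matrix `A`, the step size `μ` and the constraint set `F`: it starts at `0`, and `x (t + 1)` is a
point of `F` nearest to `x t + μ Aᵀ (Y - A x t)`. -/
def IsPGD {m n : ℕ} (A : Matrix (Fin m) (Fin n) ℝ) (Y : Fin m → ℝ) (μ : ℝ)
    (F : Set (EuclideanSpace ℝ (Fin n))) (x : ℕ → EuclideanSpace ℝ (Fin n)) : Prop :=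
  x 0 = 0 ∧ ∀ t, x (t + 1) ∈ F ∧
    IsMinOn (fun u => ‖u - (x t + μ • WithLp.toLp 2 (Aᵀ *ᵥ (Y - A *ᵥ (x t).ofLp)))‖) F (x (t + 1))

end QMAP

end

/-! Since `b n → ∞`, the number of measurements satisfies `m ≥ 4000 n` eventually, so `1 - μ AᵀA` is
small on all of `ℝ^n` and no count of the feasible words is needed. The theorem follows from a
deterministic step estimate and three events whose probabilities tend to one.

Step (`pgd_step`): let `q = [X]_b` be feasible and let `S` be the gradient point. A nearest point
`y` to `S` satisfies `‖y - q‖² ≤ 2⟨y - q, S - q⟩`, convex constraint set or not, and `S - q = (1 -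
μAᵀA)(x - q) + μAᵀA(X - q) + μAᵀZ`. The three terms yield the contraction, the quantization error
and the noise term.

Events. (1) `A` is a near isometry (`prob_not_nearIsometry_le`): a Chernoff bound for each vector of
a finite family built from a net, then polarization and a union bound. (2) `‖AᵀZ‖` is small
(`prob_norm_transpose_mulVec_le`): Markov's inequality applied to `E‖AᵀZ‖² = mnσ²`. (3) `q` is
feasible (`tendsto_prob_notMem_feasibleSet`): its cost is an average of conditional informations
over windows, with mean the conditional entropy, which is eventually at most `b(d + δ/2)`.
Chebyshev's inequality controls the average: `ψ*`-mixing handles distant pairs of windows, and a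
second moment of order `b²` handles close pairs. -/

noncomputable section

namespace QMAP

variable {Ω : Type*} [MeasurableSpace Ω]

/-! ### Gaussian sums of squares -/

/-- The rows of a random matrix with independent entries are independent. -/
lemma iIndepFun_rows {ι κ : Type*} [Countable ι] [Countable κ] {P : Measure Ω}
    {A : ι → κ → Ω → ℝ} (hA : ∀ i j, Measurable (A i j))
    (h : iIndepFun (fun p : ι × κ => A p.1 p.2) P) :
    iIndepFun (fun i ω j => A i j ω) P := by
  have := h.isProbabilityMeasure
  have hp : ∀ i j, IsProbabilityMeasure (P.map (A i j)) :=
    fun i j => Measure.isProbabilityMeasure_map (hA i j).aemeasurable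
  have hp' : ∀ i, IsProbabilityMeasure (P.map (fun ω => (A i · ω))) :=
    fun i => Measure.isProbabilityMeasure_map (Measurable.aemeasurable (by fun_prop))
  have hs : iIndepFun (fun p : (_ : ι) × κ => A p.1 p.2) P :=
    h.precomp (g := Equiv.sigmaEquivProd ι κ) (Equiv.injective _)
  have hcomp : (MeasurableEquiv.piCurry (fun (_ : ι) (_ : κ) => ℝ)) ∘
      (fun ω (p : (_ : ι) × κ) => A p.1 p.2 ω) = fun ω i j => A i j ω := by
    ext; simp [Sigma.curry]
  rw [iIndepFun_iff_map_fun_eq_infinitePi_map (by fun_prop)]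
  rw [← hcomp, ← Measure.map_map (by fun_prop) (by fun_prop),
    (iIndepFun_iff_map_fun_eq_infinitePi_map (by fun_prop)).1 hs,
    Measure.infinitePi_map_piCurry (fun i j => P.map (A i j))]
  congr 1
  funext i
  exact ((iIndepFun_iff_map_fun_eq_infinitePi_map (by fun_prop)).1
    (h.precomp (g := fun j => (i, j)) (fun _ _ hh => (Prod.ext_iff.1 hh).2))).symm

/-- A linear combination of independent standard Gaussian variables is Gaussian. -/
lemma hasLaw_sum_mul_gaussian {κ : Type*} [Fintype κ] {P : Measure Ω} [IsProbabilityMeasure P]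
    {g : κ → Ω → ℝ} (hg : ∀ j, HasLaw (g j) (gaussianReal 0 1) P) (h : iIndepFun g P)
    (z : κ → ℝ) :
    HasLaw (fun ω => ∑ j, g j ω * z j) (gaussianReal 0 (∑ j, z j ^ 2).toNNReal) P := by
  have hm : ∀ j, AEMeasurable (fun ω => g j ω * z j) P := fun j =>
    (hg j).aemeasurable.mul_const _
  refine ⟨Finset.aemeasurable_fun_sum _ fun j _ => hm j, ?_⟩
  have hpm : IsProbabilityMeasure (P.map fun ω => ∑ j, g j ω * z j) :=
    Measure.isProbabilityMeasure_map (Finset.aemeasurable_fun_sum _ fun j _ => hm j)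
  refine Measure.ext_of_charFun ?_
  have hi : iIndepFun (fun j ω => g j ω * z j) P :=
    h.comp (fun j x => x * z j) (fun j => by fun_prop)
  rw [iIndepFun.charFun_map_fun_sum_eq_prod hm hi]
  funext t
  simp only [Finset.prod_apply]
  have : ∀ j, charFun (P.map fun ω => g j ω * z j) t
      = Complex.exp (-((z j ^ 2 : ℝ) * t ^ 2 / 2)) := by
    intro j
    rw [(gaussianReal_mul_const (hg j) (z j)).map_eq, charFun_gaussianReal]
    congr 1
    simp
  simp only [this]
  rw [← Complex.exp_sum, charFun_gaussianReal]
  congr 1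
  rw [Real.coe_toNNReal _ (Finset.sum_nonneg fun _ _ => sq_nonneg _)]
  push_cast
  simp [Finset.sum_mul, Finset.sum_div, Finset.sum_neg_distrib]

/-- The moment generating function of a squared centred Gaussian variable. -/
lemma mgf_sq_gaussian {P : Measure Ω} {g : Ω → ℝ} {v : ℝ≥0} (hv : v ≠ 0)
    (hg : HasLaw g (gaussianReal 0 v) P) {s : ℝ} (hs : s < 1 / 2) :
    Integrable (fun ω => Real.exp (s / v * g ω ^ 2)) P ∧
      mgf (fun ω => g ω ^ 2) P (s / v) = (√(1 - 2 * s))⁻¹ := by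
  have hv0 : (0 : ℝ) < v := by positivity
  have hb : 0 < (1 - 2 * s) / (2 * v) := by
    apply div_pos <;> linarith
  have hpt : ∀ x : ℝ, gaussianPDFReal 0 v x * Real.exp (s / v * x ^ 2)
      = (√(2 * Real.pi * v))⁻¹ * Real.exp (-((1 - 2 * s) / (2 * v)) * x ^ 2) := by
    intro x
    rw [gaussianPDFReal, mul_assoc, ← Real.exp_add]
    congr 2
    field_simp
    ring
  have hint : Integrable (fun x : ℝ => Real.exp (s / v * x ^ 2)) (gaussianReal 0 v) := by
    rw [gaussianReal_of_var_ne_zero _ hv, gaussianPDF_def]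
    rw [integrable_withDensity_iff_integrable_smul₀' (by fun_prop) (by simp)]
    have : (fun x => (ENNReal.ofReal (gaussianPDFReal 0 v x)).toReal • Real.exp (s / v * x ^ 2))
        = fun x => (√(2 * Real.pi * v))⁻¹ * Real.exp (-((1 - 2 * s) / (2 * v)) * x ^ 2) := by
      funext x
      rw [ENNReal.toReal_ofReal (gaussianPDFReal_nonneg _ _ _), smul_eq_mul, hpt]
    rw [this]
    exact (integrable_exp_neg_mul_sq hb).const_mul _
  constructor
  · have := hg.map_eq ▸ hint
    exact (integrable_map_measure (by fun_prop) hg.aemeasurable).1 this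
  · rw [mgf]
    have h1 : ∫ ω, Real.exp (s / v * g ω ^ 2) ∂P
        = ∫ x, Real.exp (s / v * x ^ 2) ∂(gaussianReal 0 v) := by
      rw [← hg.map_eq, integral_map hg.aemeasurable (by fun_prop)]
    rw [h1, integral_gaussianReal_eq_integral_smul hv]
    simp only [smul_eq_mul, hpt]
    rw [integral_const_mul, integral_gaussian, ← Real.sqrt_inv, ← Real.sqrt_mul (by positivity),
      ← Real.sqrt_inv]
    congr 1
    have : (1 - 2 * s) ≠ 0 := by linarith
    field_simp

/-- Since `-log(1 - 2s)/2 = s + s² + O(s³)`, the coefficient `2` of `s²` leaves room for the higher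
terms when `|s| ≤ 1/4`. -/
lemma inv_sqrt_le_exp {s : ℝ} (h1 : -(1 / 4) ≤ s) (h2 : s ≤ 1 / 4) :
    (√(1 - 2 * s))⁻¹ ≤ Real.exp (s + 2 * s ^ 2) := by
  have key : Real.exp (-(2 * s + 4 * s ^ 2)) ≤ 1 - 2 * s := by
    rcases le_or_gt 0 s with h0 | h0
    · rw [Real.exp_neg, inv_le_comm₀ (Real.exp_pos _) (by linarith)]
      refine le_trans ?_ (Real.quadratic_le_exp_of_nonneg (by positivity))
      rw [inv_le_iff_one_le_mul₀ (by linarith)]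
      have : 0 ≤ s ^ 2 * ((1 - 2 * s) * (1 + 2 * s) ^ 2 - 4 * s) := by
        apply mul_nonneg (sq_nonneg _)
        nlinarith [mul_nonneg h0 h0, mul_nonneg h0 (sub_nonneg.2 h2)]
      nlinarith
    · have h3 : |(-(2 * s + 4 * s ^ 2))| ≤ 1 := by rw [abs_le]; constructor <;> nlinarith
      have h4 := (abs_le.1 (Real.abs_exp_sub_one_sub_id_le h3)).2
      have : s ^ 2 * (1 + 2 * s) ^ 2 ≤ s ^ 2 * 1 := by
        gcongr
        nlinarith
      nlinarith
  have hpos : 0 < 1 - 2 * s := by linarith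
  rw [inv_le_comm₀ (by positivity) (Real.exp_pos _), ← Real.exp_neg]
  apply Real.le_sqrt_of_sq_le
  rw [← Real.exp_nat_mul]
  convert key using 2
  push_cast; ring

/-- Chernoff bound for a sum of squares of independent centred Gaussian variables. -/
lemma chi_square_tail {ι : Type*} [Fintype ι] {P : Measure Ω} [IsProbabilityMeasure P]
    {g : ι → Ω → ℝ} {v : ℝ≥0} (hv : v ≠ 0) (hgm : ∀ i, Measurable (g i))
    (hg : ∀ i, HasLaw (g i) (gaussianReal 0 v) P) (h : iIndepFun g P) {ε : ℝ} (hε : 0 ≤ ε)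
    (hε1 : ε ≤ 1) :
    P.real {ω | ε * v * Fintype.card ι ≤ |∑ i, g i ω ^ 2 - v * Fintype.card ι|}
      ≤ 2 * Real.exp (-(ε ^ 2 / 8 * Fintype.card ι)) := by
  have hv0 : (0 : ℝ) < v := by positivity
  set N : ℝ := (Fintype.card ι : ℝ) with hN
  have hi : iIndepFun (fun i ω => g i ω ^ 2) P := h.comp (fun _ x => x ^ 2) (fun _ => by fun_prop)
  have hm : ∀ i, AEMeasurable (fun ω => g i ω ^ 2) P := fun i => (hg i).aemeasurable.pow_const _
  have hmgf : ∀ s : ℝ, -(1 / 4) ≤ s → s ≤ 1 / 4 →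
      mgf (∑ i, fun ω => g i ω ^ 2) P (s / v) ≤ Real.exp (N * (s + 2 * s ^ 2)) := by
    intro s h1 h2
    rw [hi.mgf_sum₀ hm]
    calc _ ≤ ∏ _i : ι, Real.exp (s + 2 * s ^ 2) := by
          refine Finset.prod_le_prod (fun i _ => mgf_nonneg) fun i _ => ?_
          rw [(mgf_sq_gaussian hv (hg i) (by linarith)).2]
          exact inv_sqrt_le_exp h1 h2
      _ = _ := by
          rw [Finset.prod_const, Finset.card_univ, ← Real.exp_nat_mul]
  have hint : ∀ s : ℝ, s < 1 / 2 →
      Integrable (fun ω => Real.exp (s / v * (∑ i, fun ω => g i ω ^ 2) ω)) P := by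
    intro s hs
    exact hi.integrable_exp_mul_sum (fun i => (hgm i).pow_const 2) (s := Finset.univ) fun i _ =>
      (mgf_sq_gaussian hv (hg i) hs).1
  -- The Chernoff exponent per variable is `-εs + 2s²`, least at `s = ε/4` with value `-ε²/8`. The
  -- lower tail uses `s = -ε/4`, and `ε ≤ 1` keeps `|s| ≤ 1/4`.
  have hup := measure_ge_le_exp_mul_mgf (μ := P) (X := ∑ i, fun ω => g i ω ^ 2)
    (t := ε / 4 / v) ((1 + ε) * v * N) (by positivity) (hint _ (by linarith))
  have hlo := measure_le_le_exp_mul_mgf (μ := P) (X := ∑ i, fun ω => g i ω ^ 2)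
    (t := -(ε / 4) / v) ((1 - ε) * v * N) (by rw [neg_div]; simp; positivity)
    (hint _ (by linarith))
  have hup' : P.real {ω | (1 + ε) * v * N ≤ (∑ i, fun ω => g i ω ^ 2) ω}
      ≤ Real.exp (-(ε ^ 2 / 8 * N)) := by
    refine hup.trans ((mul_le_mul_of_nonneg_left (hmgf _ (by linarith) (by linarith))
      (Real.exp_pos _).le).trans (le_of_eq ?_))
    rw [← Real.exp_add]
    congr 1
    field_simp
    ring
  have hlo' : P.real {ω | (∑ i, fun ω => g i ω ^ 2) ω ≤ (1 - ε) * v * N}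
      ≤ Real.exp (-(ε ^ 2 / 8 * N)) := by
    refine hlo.trans ((mul_le_mul_of_nonneg_left (hmgf _ (by linarith) (by linarith))
      (Real.exp_pos _).le).trans (le_of_eq ?_))
    rw [← Real.exp_add]
    congr 1
    field_simp
    ring
  have hsub : {ω | ε * v * N ≤ |∑ i, g i ω ^ 2 - v * N|} ⊆
      {ω | (1 + ε) * v * N ≤ (∑ i, fun ω => g i ω ^ 2) ω} ∪
      {ω | (∑ i, fun ω => g i ω ^ 2) ω ≤ (1 - ε) * v * N} := by
    intro ω hω
    simp only [Set.mem_ofPred_eq, Set.mem_union, Finset.sum_apply] at hω ⊢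
    rcases le_abs.1 hω with h' | h'
    · left; linarith
    · right; linarith
  calc _ ≤ _ := measureReal_mono hsub
    _ ≤ _ := measureReal_union_le _ _
    _ ≤ _ := by linarith

/-- Concentration of `‖A z‖²` for a matrix `A` with independent standard Gaussian entries. -/
lemma gaussian_matrix_mulVec_tail {ι κ : Type*} [Fintype ι] [Fintype κ] {P : Measure Ω}
    [IsProbabilityMeasure P] {A : ι → κ → Ω → ℝ}
    (hA : ∀ i j, HasLaw (A i j) (gaussianReal 0 1) P)
    (h : iIndepFun (fun p : ι × κ => A p.1 p.2) P) (z : κ → ℝ) {ε : ℝ} (hε : 0 ≤ ε)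
    (hε1 : ε ≤ 1) :
    P.real {ω | ε * (∑ j, z j ^ 2) * Fintype.card ι <
        |∑ i, (∑ j, A i j ω * z j) ^ 2 - (∑ j, z j ^ 2) * Fintype.card ι|}
      ≤ 2 * Real.exp (-(ε ^ 2 / 8 * Fintype.card ι)) := by
  -- For `z = 0` the variance degenerates; the strict inequality in the event makes it empty.
  by_cases hz : ∑ j, z j ^ 2 = 0
  · have hz' : ∀ j, z j = 0 := fun j => by
      simpa using (Finset.sum_eq_zero_iff_of_nonneg fun _ _ => sq_nonneg _).1 hz j
        (Finset.mem_univ j)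
    simp only [hz', mul_zero, Finset.sum_const_zero]
    simp
    positivity
  have hz0 : 0 ≤ ∑ j, z j ^ 2 := Finset.sum_nonneg fun _ _ => sq_nonneg _
  -- `HasLaw` gives only a.e. measurability, so measurable versions of the entries are used.
  set B : ι → κ → Ω → ℝ := fun i j => (hA i j).aemeasurable.mk (A i j)
  have hB : ∀ i j, Measurable (B i j) := fun i j => (hA i j).aemeasurable.measurable_mk
  have hAB : ∀ i j, A i j =ᵐ[P] B i j := fun i j => (hA i j).aemeasurable.ae_eq_mk
  have hBl : ∀ i j, HasLaw (B i j) (gaussianReal 0 1) P := fun i j =>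
    ⟨(hB i j).aemeasurable, by rw [← (hA i j).map_eq]; exact Measure.map_congr (hAB i j).symm⟩
  have hBi : iIndepFun (fun p : ι × κ => B p.1 p.2) P := h.congr fun p => hAB p.1 p.2
  have hrow : iIndepFun (fun i ω => ∑ j, B i j ω * z j) P :=
    (iIndepFun_rows hB hBi).comp (fun _ x => ∑ j, x j * z j) (fun _ => by fun_prop)
  have hlaw : ∀ i, HasLaw (fun ω => ∑ j, B i j ω * z j)
      (gaussianReal 0 (∑ j, z j ^ 2).toNNReal) P := fun i =>
    hasLaw_sum_mul_gaussian (hBl i)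
      (hBi.precomp (g := fun j => (i, j)) (fun _ _ hh => (Prod.ext_iff.1 hh).2)) z
  have hv : (∑ j, z j ^ 2).toNNReal ≠ 0 := by
    simpa using lt_of_le_of_ne hz0 (Ne.symm hz)
  have key := chi_square_tail hv (fun i => by fun_prop) hlaw hrow hε hε1
  rw [Real.coe_toNNReal _ hz0] at key
  refine le_trans ?_ key
  have hae : ∀ᵐ ω ∂P, ∀ i j, A i j ω = B i j ω := ae_all_iff.2 fun i => ae_all_iff.2 (hAB i)
  refine ENNReal.toReal_mono (measure_ne_top _ _) (measure_mono_ae ?_)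
  filter_upwards [hae] with ω hω hlt
  change _ < _ at hlt
  change _ ≤ _
  simp only [hω] at hlt
  exact le_of_lt hlt

/-- The second moment of `‖Aᵀ Z‖` for independent `A` and `Z`. -/
lemma integral_sq_norm_transpose_mulVec {ι κ : Type*} [Fintype ι] [Fintype κ] {P : Measure Ω}
    [IsProbabilityMeasure P] {A : ι → κ → Ω → ℝ} {Z : ι → Ω → ℝ} {σ : ℝ≥0}
    (hA : ∀ i j, HasLaw (A i j) (gaussianReal 0 1) P)
    (hZ : ∀ i, HasLaw (Z i) (gaussianReal 0 (σ ^ 2)) P) (hZi : iIndepFun Z P)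
    (hAZ : IndepFun (fun ω i j => A i j ω) (fun ω i => Z i ω) P) :
    Integrable (fun ω => ∑ j, (∑ i, A i j ω * Z i ω) ^ 2) P ∧
    ∫ ω, ∑ j, (∑ i, A i j ω * Z i ω) ^ 2 ∂P = Fintype.card κ * (Fintype.card ι * σ ^ 2) := by
  have hAL : ∀ i j, MemLp (A i j) 2 P := fun i j => by
    have := (hA i j).map_eq ▸ (memLp_id_gaussianReal (μ := 0) (v := 1) 2)
    exact (memLp_map_measure_iff (by fun_prop) (hA i j).aemeasurable).1 this
  have hZL : ∀ i, MemLp (Z i) 2 P := fun i => by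
    have := (hZ i).map_eq ▸ (memLp_id_gaussianReal (μ := 0) (v := σ ^ 2) 2)
    exact (memLp_map_measure_iff (by fun_prop) (hZ i).aemeasurable).1 this
  have hA1 : ∀ i j, ∫ ω, A i j ω * A i j ω ∂P = 1 := fun i j => by
    have h1 := (hA i j).variance_eq
    have h2 := (hA i j).integral_eq
    rw [integral_id_gaussianReal] at h2
    rw [variance_id_gaussianReal, variance_eq_sub (hAL i j), h2] at h1
    simpa [sq] using h1
  have hZ0 : ∀ i, ∫ ω, Z i ω ∂P = 0 := fun i => by
    have h2 := (hZ i).integral_eq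
    rwa [integral_id_gaussianReal] at h2
  have hZ1 : ∀ i, ∫ ω, Z i ω * Z i ω ∂P = σ ^ 2 := fun i => by
    have h1 := (hZ i).variance_eq
    rw [variance_id_gaussianReal, variance_eq_sub (hZL i), hZ0 i] at h1
    simpa [sq] using h1
  have hZ2 : ∀ i i', i ≠ i' → ∫ ω, Z i ω * Z i' ω ∂P = 0 := fun i i' hne => by
    have := (hZi.indepFun hne).integral_mul_eq_mul_integral (hZL i).1 (hZL i').1
    simpa [hZ0] using this
  have hind : ∀ i i' j, IndepFun (fun ω => A i j ω * A i' j ω) (fun ω => Z i ω * Z i' ω) P :=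
    fun i i' j => hAZ.comp (φ := fun a : ι → κ → ℝ => a i j * a i' j)
      (ψ := fun z : ι → ℝ => z i * z i')
      (by fun_prop) (by fun_prop)
  have hAI : ∀ i i' j, Integrable (fun ω => A i j ω * A i' j ω) P := fun i i' j =>
    (hAL i j).integrable_mul (hAL i' j)
  have hZI : ∀ i i', Integrable (fun ω => Z i ω * Z i' ω) P := fun i i' =>
    (hZL i).integrable_mul (hZL i')
  have hI : ∀ i i' j, Integrable (fun ω => (A i j ω * A i' j ω) * (Z i ω * Z i' ω)) P :=
    fun i i' j => (hind i i' j).integrable_mul (hAI i i' j) (hZI i i')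
  have hE : ∀ i i' j, ∫ ω, (A i j ω * A i' j ω) * (Z i ω * Z i' ω) ∂P
      = (∫ ω, A i j ω * A i' j ω ∂P) * ∫ ω, Z i ω * Z i' ω ∂P := fun i i' j =>
    (hind i i' j).integral_mul_eq_mul_integral (hAI i i' j).1 (hZI i i').1
  -- In the expanded square the terms with `i ≠ i'` vanish because `E[Z i * Z i'] = 0`; each
  -- diagonal term contributes `σ²`.
  have hexp : (fun ω => ∑ j, (∑ i, A i j ω * Z i ω) ^ 2)
      = fun ω => ∑ j, ∑ i, ∑ i', (A i j ω * A i' j ω) * (Z i ω * Z i' ω) := by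
    funext ω
    refine Finset.sum_congr rfl fun j _ => ?_
    rw [sq, Finset.sum_mul_sum]
    exact Finset.sum_congr rfl fun i _ => Finset.sum_congr rfl fun i' _ => by ring
  rw [hexp]
  refine ⟨integrable_finsetSum _ fun j _ => integrable_finsetSum _ fun i _ =>
    integrable_finsetSum _ fun i' _ => hI i i' j, ?_⟩
  rw [integral_finsetSum _ fun j _ => integrable_finsetSum _ fun i _ =>
    integrable_finsetSum _ fun i' _ => hI i i' j]
  have hj : ∀ j, ∫ ω, ∑ i, ∑ i', (A i j ω * A i' j ω) * (Z i ω * Z i' ω) ∂P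
      = Fintype.card ι * σ ^ 2 := by
    intro j
    rw [integral_finsetSum _ fun i _ => integrable_finsetSum _ fun i' _ => hI i i' j]
    have : ∀ i, ∫ ω, ∑ i', (A i j ω * A i' j ω) * (Z i ω * Z i' ω) ∂P = σ ^ 2 := by
      intro i
      rw [integral_finsetSum _ fun i' _ => hI i i' j, Finset.sum_eq_single i]
      · rw [hE, hA1, hZ1, one_mul]
      · intro i' _ hne
        rw [hE, hZ2 i i' hne.symm, mul_zero]
      · simp
    simp [this]
  simp [hj]

/-! ### Nets and near isometries -/

/-- The ball of radius `2` has a `1`-net of at most `5 ^ dim` points. -/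
lemma exists_net (E : Type*) [NormedAddCommGroup E] [NormedSpace ℝ E] [FiniteDimensional ℝ E] :
    ∃ s : Finset E, s.card ≤ 5 ^ Module.finrank ℝ E ∧ (∀ c ∈ s, ‖c‖ ≤ 2) ∧
      ∀ x : E, ‖x‖ ≤ 2 → ∃ c ∈ s, ‖x - c‖ ≤ 1 := by
  classical
  -- A `1`-separated subset of largest cardinality is a `1`-net: a point far from all of it could be
  -- added. Besicovitch's packing bound makes a largest one exist.
  let Q : ℕ → Prop := fun N => ∃ s : Finset E, s.card = N ∧ (∀ c ∈ s, ‖c‖ ≤ 2) ∧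
    ∀ c ∈ s, ∀ d ∈ s, c ≠ d → 1 ≤ ‖c - d‖
  have hbd : ∀ N, Q N → N ≤ 5 ^ Module.finrank ℝ E := by
    rintro N ⟨s, rfl, h1, h2⟩
    exact Besicovitch.card_le_of_separated s h1 h2
  have hQ0 : Q 0 := ⟨∅, by simp⟩
  obtain ⟨s, hs, h1, h2⟩ : Q (Nat.findGreatest Q (5 ^ Module.finrank ℝ E)) :=
    Nat.findGreatest_spec (Nat.zero_le _) hQ0
  refine ⟨s, hs ▸ Nat.findGreatest_le _, h1, fun x hx => ?_⟩
  by_contra! hcon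
  have hxs : x ∉ s := fun hx' => by
    have := hcon x hx'
    simp at this
    linarith
  have hQ : Q (s.card + 1) := by
    refine ⟨insert x s, Finset.card_insert_of_notMem hxs, ?_, ?_⟩
    · intro c hc
      rcases Finset.mem_insert.1 hc with rfl | hc
      exacts [hx, h1 c hc]
    · intro c hc d hd hne
      rcases Finset.mem_insert.1 hc with hc' | hc' <;>
        rcases Finset.mem_insert.1 hd with hd' | hd'
      · exact absurd (hc'.trans hd'.symm) hne
      · rw [hc']; exact (hcon d hd').le
      · rw [hd', norm_sub_rev]; exact (hcon c hc').le
      · exact h2 c hc' d hd' hne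
  have := Nat.le_findGreatest (hbd _ hQ) hQ
  omega

section Net

variable {E : Type*} [NormedAddCommGroup E] [InnerProductSpace ℝ E]

/-- Rescale `v` to length `2` and approximate it by `y` in the net: `2‖v‖ ≤ ⟨v, y⟩ + ‖v‖`, so
passing to the net costs no constant. -/
lemma norm_le_of_net {s : Finset E} (hs : ∀ x : E, ‖x‖ ≤ 2 → ∃ c ∈ s, ‖x - c‖ ≤ 1) {v : E} {c : ℝ}
    (hv : ∀ y ∈ s, |inner ℝ v y| ≤ c) : ‖v‖ ≤ c := by
  rcases eq_or_ne v 0 with rfl | hv0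
  · obtain ⟨y, hy, -⟩ := hs 0 (by simp)
    simpa using hv y hy
  have hn : 0 < ‖v‖ := norm_pos_iff.2 hv0
  obtain ⟨y, hy, hxy⟩ := hs ((2 / ‖v‖) • v) (by
    rw [norm_smul, Real.norm_of_nonneg (by positivity), div_mul_cancel₀ _ hn.ne'])
  have h1 : inner ℝ v ((2 / ‖v‖) • v) = 2 * ‖v‖ := by
    rw [inner_smul_right, real_inner_self_eq_norm_sq]
    field_simp
  have h2 : inner ℝ v ((2 / ‖v‖) • v) = inner ℝ v y + inner ℝ v ((2 / ‖v‖) • v - y) := by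
    rw [← inner_add_right]; simp
  have h3 : inner ℝ v ((2 / ‖v‖) • v - y) ≤ ‖v‖ * 1 :=
    (real_inner_le_norm _ _).trans (by gcongr)
  have h4 := (abs_le.1 (hv y hy)).2
  linarith

/-- The same absorption, once for each argument of the bilinear form; it gives `‖T‖ ≤ (c + ‖T‖) /
2`. -/
lemma opNorm_le_of_net {s : Finset E} (hs : ∀ x : E, ‖x‖ ≤ 2 → ∃ c ∈ s, ‖x - c‖ ≤ 1)
    (T : E →L[ℝ] E) {c : ℝ} (hT : ∀ x ∈ s, ∀ y ∈ s, |inner ℝ (T x) y| ≤ c) : ‖T‖ ≤ c := by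
  have h1 : ∀ x ∈ s, ‖T x‖ ≤ c := fun x hx => norm_le_of_net hs (hT x hx)
  have hc : 0 ≤ c := by
    obtain ⟨y, hy, -⟩ := hs 0 (by simp)
    exact (norm_nonneg _).trans (h1 y hy)
  have h2 : ‖T‖ ≤ (c + ‖T‖) / 2 := by
    refine T.opNorm_le_bound (by positivity) fun x => ?_
    rcases eq_or_ne x 0 with rfl | hx0
    · simp
    have hn : 0 < ‖x‖ := norm_pos_iff.2 hx0
    obtain ⟨y, hy, hxy⟩ := hs ((2 / ‖x‖) • x) (by
      rw [norm_smul, Real.norm_of_nonneg (by positivity), div_mul_cancel₀ _ hn.ne'])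
    have h3 : (2 / ‖x‖) * ‖T x‖ = ‖T ((2 / ‖x‖) • x)‖ := by
      rw [map_smul, norm_smul, Real.norm_of_nonneg (by positivity)]
    have h4 : T ((2 / ‖x‖) • x) = T y + T ((2 / ‖x‖) • x - y) := by
      rw [← map_add]; simp
    have h5 : (2 / ‖x‖) * ‖T x‖ ≤ c + ‖T‖ := by
      rw [h3, h4]
      refine (norm_add_le _ _).trans (add_le_add (h1 y hy) ?_)
      calc _ ≤ ‖T‖ * ‖(2 / ‖x‖) • x - y‖ := T.le_opNorm _
        _ ≤ ‖T‖ * 1 := by gcongr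
        _ = _ := mul_one _
    rw [div_mul_eq_mul_div, div_le_iff₀ hn] at h5
    linarith
  linarith

/-- Concentration controls only quadratic forms, hence polarization: `4⟨Tx, y⟩` is a difference of
values at `x + y` and `x - y`, whose squared norms sum to at most `16` by the parallelogram law. -/
lemma opNorm_le_of_net_quadratic {s : Finset E}
    (hs : ∀ x : E, ‖x‖ ≤ 2 → ∃ c ∈ s, ‖x - c‖ ≤ 1) (hs2 : ∀ c ∈ s, ‖c‖ ≤ 2)
    (T : E →L[ℝ] E) (hsym : ∀ x y, inner ℝ (T x) y = inner ℝ (T y) x) {ε : ℝ} (hε : 0 ≤ ε)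
    (hadd : ∀ x ∈ s, ∀ y ∈ s, |inner ℝ (T (x + y)) (x + y)| ≤ ε * ‖x + y‖ ^ 2)
    (hsub : ∀ x ∈ s, ∀ y ∈ s, |inner ℝ (T (x - y)) (x - y)| ≤ ε * ‖x - y‖ ^ 2) :
    ‖T‖ ≤ 4 * ε := by
  refine opNorm_le_of_net hs T fun x hx y hy => ?_
  have hpol : 4 * inner ℝ (T x) y
      = inner ℝ (T (x + y)) (x + y) - inner ℝ (T (x - y)) (x - y) := by
    simp only [map_add, map_sub, inner_add_left, inner_add_right, inner_sub_left, inner_sub_right]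
    rw [hsym y x]
    ring
  have h1 := abs_le.1 (hadd x hx y hy)
  have h2 := abs_le.1 (hsub x hx y hy)
  have h3 : ‖x + y‖ ^ 2 + ‖x - y‖ ^ 2 = 2 * (‖x‖ ^ 2 + ‖y‖ ^ 2) := by
    have := parallelogram_law_with_norm ℝ x y
    nlinarith
  have h4 : ‖x‖ ^ 2 ≤ 4 := by nlinarith [hs2 x hx, norm_nonneg x]
  have h5 : ‖y‖ ^ 2 ≤ 4 := by nlinarith [hs2 y hy, norm_nonneg y]
  have h6 : ε * ‖x + y‖ ^ 2 + ε * ‖x - y‖ ^ 2 ≤ 16 * ε := by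
    rw [← mul_add, h3]; nlinarith
  rw [abs_le]
  constructor <;> linarith [h1.1, h1.2, h2.1, h2.2]

end Net

/-- `A` is nearly an isometry up to the scaling `μ`. -/
def NearIsometry {m n : ℕ} (A : Matrix (Fin m) (Fin n) ℝ) (μ : ℝ) : Prop :=
  ∀ v w : EuclideanSpace ℝ (Fin n),
    |inner ℝ v w - μ * ((A *ᵥ v.ofLp) ⬝ᵥ (A *ᵥ w.ofLp))| ≤ 0.4 * ‖v‖ * ‖w‖

lemma nearIsometry_of_net {m n : ℕ} (A : Matrix (Fin m) (Fin n) ℝ) (μ : ℝ)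
    {s : Finset (EuclideanSpace ℝ (Fin n))}
    (hs : ∀ x : EuclideanSpace ℝ (Fin n), ‖x‖ ≤ 2 → ∃ c ∈ s, ‖x - c‖ ≤ 1)
    (hs2 : ∀ c ∈ s, ‖c‖ ≤ 2)
    (hadd : ∀ x ∈ s, ∀ y ∈ s, ∀ z, z = x + y ∨ z = x - y →
      |‖z‖ ^ 2 - μ * ((A *ᵥ z.ofLp) ⬝ᵥ (A *ᵥ z.ofLp))| ≤ 0.1 * ‖z‖ ^ 2) :
    NearIsometry A μ := by
  let T := Matrix.toEuclideanCLM (𝕜 := ℝ) (1 - μ • (Aᵀ * A))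
  have hT : ∀ v w, inner ℝ (T v) w = inner ℝ v w - μ * ((A *ᵥ v.ofLp) ⬝ᵥ (A *ᵥ w.ofLp)) := by
    intro v w
    have h1 : (T v).ofLp = v.ofLp - μ • (Aᵀ *ᵥ (A *ᵥ v.ofLp)) := by
      change (Matrix.toEuclideanCLM (𝕜 := ℝ) (1 - μ • (Aᵀ * A)) v).ofLp = _
      rw [Matrix.ofLp_toEuclideanCLM, Matrix.sub_mulVec, Matrix.smul_mulVec, Matrix.one_mulVec,
        Matrix.mulVec_mulVec]
    have hin : ∀ a c : EuclideanSpace ℝ (Fin n), inner ℝ a c = c.ofLp ⬝ᵥ a.ofLp := fun a c => by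
      rw [EuclideanSpace.inner_eq_star_dotProduct]; simp
    rw [hin, hin, h1, dotProduct_sub, dotProduct_smul, smul_eq_mul, Matrix.dotProduct_mulVec,
      Matrix.vecMul_transpose, dotProduct_comm (A *ᵥ w.ofLp)]
  have hn : ‖T‖ ≤ 4 * 0.1 := by
    refine opNorm_le_of_net_quadratic hs hs2 T ?_ (by norm_num) ?_ ?_
    · intro x y
      rw [hT, hT, real_inner_comm, dotProduct_comm]
    · intro x hx y hy
      rw [hT, real_inner_self_eq_norm_sq]
      exact hadd x hx y hy _ (Or.inl rfl)
    · intro x hx y hy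
      rw [hT, real_inner_self_eq_norm_sq]
      exact hadd x hx y hy _ (Or.inr rfl)
  intro v w
  rw [← hT]
  calc _ ≤ ‖T v‖ * ‖w‖ := abs_real_inner_le_norm _ _
    _ ≤ ‖T‖ * ‖v‖ * ‖w‖ := by gcongr; exact T.le_opNorm v
    _ ≤ 0.4 * ‖v‖ * ‖w‖ := by gcongr; linarith

/-- Union bound over the at most `2 * 25 ^ n` vectors `x ± y` with `x`, `y` in the net, each failing
with probability at most `2 exp(-0.1² m / 8)`. -/
lemma prob_not_nearIsometry_le {m n : ℕ} (hm : 0 < m) {P : Measure Ω} [IsProbabilityMeasure P]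
    {A : Fin m → Fin n → Ω → ℝ} (hA : ∀ i j, HasLaw (A i j) (gaussianReal 0 1) P)
    (h : iIndepFun (fun p : Fin m × Fin n => A p.1 p.2) P) :
    P {ω | ¬ NearIsometry (Matrix.of fun i j => A i j ω) (1 / m)} ≤
      ENNReal.ofReal (4 * 25 ^ n * Real.exp (-(m / 800))) := by
  classical
  obtain ⟨s, hcard, hs2, hs⟩ := exists_net (EuclideanSpace ℝ (Fin n))
  rw [finrank_euclideanSpace_fin] at hcard
  let F : Finset (EuclideanSpace ℝ (Fin n)) :=
    (s ×ˢ s).image (fun p => p.1 + p.2) ∪ (s ×ˢ s).image (fun p => p.1 - p.2)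
  have hF : (F.card : ℝ) ≤ 2 * 25 ^ n := by
    have : F.card ≤ 2 * 25 ^ n := by
      calc F.card ≤ _ := Finset.card_union_le _ _
        _ ≤ (s ×ˢ s).card + (s ×ˢ s).card :=
          add_le_add Finset.card_image_le Finset.card_image_le
        _ = 2 * (s.card * s.card) := by rw [Finset.card_product]; ring
        _ ≤ 2 * (5 ^ n * 5 ^ n) := by gcongr
        _ = 2 * 25 ^ n := by rw [← mul_pow]; norm_num
    exact_mod_cast this
  let bad : EuclideanSpace ℝ (Fin n) → Set Ω := fun z =>
    {ω | 0.1 * (∑ j, z j ^ 2) * Fintype.card (Fin m) <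
        |∑ i, (∑ j, A i j ω * z j) ^ 2 - (∑ j, z j ^ 2) * Fintype.card (Fin m)|}
  have hbad : ∀ z, P (bad z) ≤ ENNReal.ofReal (2 * Real.exp (-(m / 800))) := by
    intro z
    have := gaussian_matrix_mulVec_tail hA h z.ofLp (ε := 0.1) (by norm_num) (by norm_num)
    rw [measureReal_def, ← ENNReal.le_ofReal_iff_toReal_le (measure_ne_top _ _)
      (by positivity)] at this
    refine this.trans (le_of_eq ?_)
    rw [Fintype.card_fin]
    congr 4
    ring
  have hsub : {ω | ¬ NearIsometry (Matrix.of fun i j => A i j ω) (1 / m)} ⊆ ⋃ z ∈ F, bad z := by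
    intro ω hω
    by_contra hcon
    refine hω (nearIsometry_of_net _ _ hs hs2 fun x hx y hy z hz => ?_)
    have hzF : z ∈ F := by
      rw [Finset.mem_union, Finset.mem_image, Finset.mem_image]
      rcases hz with rfl | rfl
      · exact Or.inl ⟨(x, y), Finset.mem_product.2 ⟨hx, hy⟩, rfl⟩
      · exact Or.inr ⟨(x, y), Finset.mem_product.2 ⟨hx, hy⟩, rfl⟩
    have hz' : ω ∉ bad z := fun h' => hcon (Set.mem_biUnion hzF h')
    have hz'' : |∑ i, (∑ j, A i j ω * z j) ^ 2 - (∑ j, z j ^ 2) * Fintype.card (Fin m)| ≤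
        0.1 * (∑ j, z j ^ 2) * Fintype.card (Fin m) := not_lt.1 hz'
    rw [Fintype.card_fin] at hz''
    have hnorm : ‖z‖ ^ 2 = ∑ j, z j ^ 2 := by
      rw [EuclideanSpace.real_norm_sq_eq]
    have hdot : ((Matrix.of fun i j => A i j ω) *ᵥ z.ofLp) ⬝ᵥ
        ((Matrix.of fun i j => A i j ω) *ᵥ z.ofLp) = ∑ i, (∑ j, A i j ω * z j) ^ 2 := by
      simp [dotProduct, Matrix.mulVec, sq]
    rw [hnorm, hdot]
    have hm0 : (0 : ℝ) < m := by exact_mod_cast hm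
    have : (∑ j, z j ^ 2) - 1 / m * ∑ i, (∑ j, A i j ω * z j) ^ 2
        = -(1 / m) * (∑ i, (∑ j, A i j ω * z j) ^ 2 - (∑ j, z j ^ 2) * m) := by
      field_simp
      ring
    rw [this, abs_mul, abs_neg, abs_of_pos (by positivity)]
    calc _ ≤ 1 / (m : ℝ) * (0.1 * (∑ j, z j ^ 2) * m) := by gcongr
      _ = _ := by field_simp
  calc _ ≤ P (⋃ z ∈ F, bad z) := measure_mono hsub
    _ ≤ ∑ z ∈ F, P (bad z) := measure_biUnion_finset_le _ _
    _ ≤ ∑ z ∈ F, ENNReal.ofReal (2 * Real.exp (-(m / 800))) := Finset.sum_le_sum fun z _ => hbad z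
    _ = ENNReal.ofReal (F.card * (2 * Real.exp (-(m / 800)))) := by
        rw [Finset.sum_const, nsmul_eq_mul, ENNReal.ofReal_mul (p := (F.card : ℝ)) (by positivity),
          ENNReal.ofReal_natCast]
    _ ≤ _ := by
        apply ENNReal.ofReal_le_ofReal
        calc _ ≤ (2 * 25 ^ n) * (2 * Real.exp (-(m / 800))) := by gcongr
          _ = _ := by ring

/-! ### The deterministic descent step -/

/-- One step of projected gradient descent towards a feasible point `q`. -/
lemma pgd_step {m n : ℕ} {A : Matrix (Fin m) (Fin n) ℝ} {μ : ℝ} (hμ : 0 ≤ μ)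
    (hA : NearIsometry A μ) {F : Set (EuclideanSpace ℝ (Fin n))}
    {q x ξ y : EuclideanSpace ℝ (Fin n)} {Z : Fin m → ℝ} (hq : q ∈ F)
    (hy : IsMinOn (fun u => ‖u - (x + μ • WithLp.toLp 2 (Aᵀ *ᵥ (A *ᵥ ξ.ofLp + Z - A *ᵥ x.ofLp)))‖)
      F y) :
    ‖y - q‖ ≤ 0.9 * ‖x - q‖ + 2.8 * ‖ξ - q‖ + 2 * (μ * ‖WithLp.toLp 2 (Aᵀ *ᵥ Z)‖) := by
  set S := x + μ • WithLp.toLp 2 (Aᵀ *ᵥ (A *ᵥ ξ.ofLp + Z - A *ᵥ x.ofLp)) with hS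
  have h1 : ‖y - S‖ ≤ ‖q - S‖ := hy hq
  -- Only the comparison of `y` with `q` is used; the factor `2` is the price of a nonconvex
  -- constraint set.
  have h2 : ‖y - q‖ ^ 2 ≤ 2 * inner ℝ (y - q) (S - q) := by
    have e1 : y - S = (y - q) - (S - q) := by abel
    have e2 : q - S = -(S - q) := by abel
    rw [e1, e2, norm_neg] at h1
    have h3 : ‖(y - q) - (S - q)‖ ^ 2 ≤ ‖S - q‖ ^ 2 := by gcongr
    rw [norm_sub_sq_real] at h3
    linarith
  have hin : ∀ a c : EuclideanSpace ℝ (Fin n), inner ℝ a c = c.ofLp ⬝ᵥ a.ofLp := fun a c => by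
    rw [EuclideanSpace.inner_eq_star_dotProduct]; simp
  set e := y - q with he
  have h4 : inner ℝ e (S - q) =
      (inner ℝ e (x - q) - μ * ((A *ᵥ e.ofLp) ⬝ᵥ (A *ᵥ (x - q).ofLp)))
      + μ * ((A *ᵥ e.ofLp) ⬝ᵥ (A *ᵥ (ξ - q).ofLp))
      + μ * inner ℝ e (WithLp.toLp 2 (Aᵀ *ᵥ Z)) := by
    have : S - q = (x - q) + μ • WithLp.toLp 2 (Aᵀ *ᵥ (A *ᵥ ξ.ofLp + Z - A *ᵥ x.ofLp)) := by
      rw [hS]; abel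
    rw [this, inner_add_right, inner_smul_right]
    have h5 : inner ℝ e (WithLp.toLp 2 (Aᵀ *ᵥ (A *ᵥ ξ.ofLp + Z - A *ᵥ x.ofLp)))
        = (A *ᵥ e.ofLp) ⬝ᵥ (A *ᵥ (ξ - q).ofLp) - (A *ᵥ e.ofLp) ⬝ᵥ (A *ᵥ (x - q).ofLp)
          + inner ℝ e (WithLp.toLp 2 (Aᵀ *ᵥ Z)) := by
      have h6 : ∀ u, inner ℝ e (WithLp.toLp 2 (Aᵀ *ᵥ u)) = (A *ᵥ e.ofLp) ⬝ᵥ u := fun u => by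
        rw [hin, dotProduct_comm, Matrix.dotProduct_mulVec, Matrix.vecMul_transpose]
      rw [h6, h6, WithLp.ofLp_sub _ ξ, WithLp.ofLp_sub _ x, Matrix.mulVec_sub, Matrix.mulVec_sub]
      simp only [dotProduct_sub, dotProduct_add]
      ring
    rw [h5]
    ring
  have h7 := (abs_le.1 (hA e (x - q))).2
  -- Near isometry bounds `μ⟨Ae, Aw⟩` by `⟨e, w⟩ + 0.4‖e‖‖w‖`, hence the factor `1.4`.
  have h8 : μ * ((A *ᵥ e.ofLp) ⬝ᵥ (A *ᵥ (ξ - q).ofLp)) ≤ 1.4 * ‖e‖ * ‖ξ - q‖ := by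
    have := (abs_le.1 (hA e (ξ - q))).1
    have := real_inner_le_norm e (ξ - q)
    linarith
  have h9 : μ * inner ℝ e (WithLp.toLp 2 (Aᵀ *ᵥ Z)) ≤ μ * (‖e‖ * ‖WithLp.toLp 2 (Aᵀ *ᵥ Z)‖) :=
    mul_le_mul_of_nonneg_left (real_inner_le_norm _ _) hμ
  rcases eq_or_lt_of_le (norm_nonneg e) with h0 | h0
  · rw [← h0]; positivity
  · have h10 : ‖e‖ * ‖e‖ ≤ ‖e‖ *
        (0.8 * ‖x - q‖ + 2.8 * ‖ξ - q‖ + 2 * (μ * ‖WithLp.toLp 2 (Aᵀ *ᵥ Z)‖)) := by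
      nlinarith
    have := le_of_mul_le_mul_left h10 h0
    linarith [norm_nonneg (x - q)]

/-! ### Second moments and mixing -/

/-- Chebyshev's inequality in `ℝ≥0∞`. -/
lemma sq_mul_meas_add_sq_le {P : Measure Ω} [IsProbabilityMeasure P] {S : Ω → ℝ≥0∞}
    (hS : Measurable S) (hfin : ∫⁻ ω, S ω ∂P ≠ ∞) (t : ℝ≥0∞) :
    t ^ 2 * P {ω | ∫⁻ ω, S ω ∂P + t ≤ S ω} + (∫⁻ ω, S ω ∂P) ^ 2 ≤ ∫⁻ ω, S ω ^ 2 ∂P := by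
  set c := ∫⁻ ω, S ω ∂P with hc
  have hms : MeasurableSet {ω | c + t ≤ S ω} := measurableSet_le measurable_const hS
  -- This is `t² 1_{S ≥ c + t} ≤ (S - c)²` rearranged to avoid truncated subtraction; after
  -- integration one `c²` cancels because the mean is finite.
  have hpt : ∀ ω, {ω | c + t ≤ S ω}.indicator (fun _ => t ^ 2) ω + 2 * c * S ω ≤ S ω ^ 2 + c ^ 2 := by
    intro ω
    rcases eq_or_ne (S ω) ∞ with h | h
    · simp [h]
    by_cases hω : ω ∈ {ω | c + t ≤ S ω}
    · rw [Set.indicator_of_mem hω]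
      have h1 : c + t ≤ S ω := hω
      obtain ⟨d, hd⟩ := exists_add_of_le h1
      rw [hd]
      calc t ^ 2 + 2 * c * (c + t + d) ≤ t ^ 2 + 2 * c * (c + t + d) + (2 * t * d + d ^ 2) :=
            le_self_add
        _ = (c + t + d) ^ 2 + c ^ 2 := by ring
    · rw [Set.indicator_of_notMem hω, zero_add]
      rcases le_total c (S ω) with h1 | h1 <;> obtain ⟨d, hd⟩ := exists_add_of_le h1 <;> rw [hd]
      · calc _ ≤ 2 * c * (c + d) + d ^ 2 := le_self_add
          _ = _ := by ring
      · calc _ ≤ 2 * (S ω + d) * S ω + d ^ 2 := le_self_add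
          _ = _ := by ring
  have hint := lintegral_mono (μ := P) hpt
  rw [lintegral_add_left (measurable_const.indicator hms), lintegral_const_mul _ hS,
    lintegral_indicator_const hms, lintegral_add_right _ measurable_const, lintegral_const,
    measure_univ, mul_one, ← hc] at hint
  have h2 : 2 * c * c = c ^ 2 + c ^ 2 := by ring
  rw [h2, ← add_assoc] at hint
  exact (ENNReal.add_le_add_iff_right (ENNReal.pow_ne_top hfin)).1 hint

/-- Products of a past and a future functional with countably many values. -/
lemma lintegral_mul_le_psiStar {P : Measure Ω} [IsProbabilityMeasure P] {X : ℕ → Ω → ℝ} {j g : ℕ} {α : Type*} [Countable α]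
    [MeasurableSpace α] [MeasurableSingletonClass α] {U V : Ω → α} {u v : α → ℝ≥0∞}
    (hX : ∀ i, Measurable (X i))
    (hU : Measurable[pastSigma X j] U) (hV : Measurable[futureSigma X (j + g)] V) :
    ∫⁻ ω, u (U ω) * v (V ω) ∂P ≤
      psiStar P X g * ((∫⁻ ω, u (U ω) ∂P) * ∫⁻ ω, v (V ω) ∂P) := by
  have hp : pastSigma X j ≤ ‹MeasurableSpace Ω› := iSup₂_le fun i _ => (hX i).comap_le
  have hf : futureSigma X (j + g) ≤ ‹MeasurableSpace Ω› := iSup₂_le fun i _ => (hX i).comap_le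
  have hU' : Measurable U := hU.mono hp le_rfl
  have hV' : Measurable V := hV.mono hf le_rfl
  -- The coefficient is applied to pairs of atoms and the bound is then summed. Null atoms are
  -- separate because the supremum ranges over events of positive probability.
  have h1 : ∀ a c, P (U ⁻¹' {a} ∩ V ⁻¹' {c}) ≤
      psiStar P X g * (P (U ⁻¹' {a}) * P (V ⁻¹' {c})) := by
    intro a c
    rcases eq_or_ne (P (U ⁻¹' {a})) 0 with h0 | h0
    · rw [measure_mono_null Set.inter_subset_left h0]; exact zero_le
    rcases eq_or_ne (P (V ⁻¹' {c})) 0 with h0' | h0'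
    · rw [measure_mono_null Set.inter_subset_right h0']; exact zero_le
    have hne : P (U ⁻¹' {a}) * P (V ⁻¹' {c}) ≠ 0 := mul_ne_zero h0 h0'
    have hle : P (U ⁻¹' {a} ∩ V ⁻¹' {c}) / (P (U ⁻¹' {a}) * P (V ⁻¹' {c})) ≤ psiStar P X g :=
      le_iSup_of_le j <| le_iSup_of_le (U ⁻¹' {a}) <| le_iSup_of_le (V ⁻¹' {c}) <|
        le_iSup_of_le (hU (measurableSet_singleton a)) <|
        le_iSup_of_le (hV (measurableSet_singleton c)) <|
        le_iSup_of_le (pos_iff_ne_zero.2 h0) <| le_iSup_of_le (pos_iff_ne_zero.2 h0') le_rfl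
    rwa [ENNReal.div_le_iff hne (ENNReal.mul_ne_top (measure_ne_top _ _) (measure_ne_top _ _))]
      at hle
  have h2 : ∫⁻ ω, u (U ω) * v (V ω) ∂P = ∑' a, ∑' c, u a * v c * P (U ⁻¹' {a} ∩ V ⁻¹' {c}) := by
    have := lintegral_map (μ := P) (f := fun p : α × α => u p.1 * v p.2)
      (measurable_of_countable _) (hU'.prodMk hV')
    rw [← this, lintegral_countable', ENNReal.tsum_prod']
    refine tsum_congr fun a => tsum_congr fun c => ?_
    rw [Measure.map_apply (hU'.prodMk hV') (measurableSet_singleton _)]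
    congr 2
    ext ω; simp
  have h3 : ∀ {W : Ω → α} (_ : Measurable W) (w : α → ℝ≥0∞),
      ∫⁻ ω, w (W ω) ∂P = ∑' a, w a * P (W ⁻¹' {a}) := by
    intro W hW w
    rw [← lintegral_map (μ := P) (measurable_of_countable w) hW, lintegral_countable']
    exact tsum_congr fun a => by rw [Measure.map_apply hW (measurableSet_singleton _)]
  rw [h2, h3 hU', h3 hV']
  calc _ ≤ ∑' a, ∑' c, psiStar P X g * ((u a * P (U ⁻¹' {a})) * (v c * P (V ⁻¹' {c}))) := by
        refine ENNReal.tsum_le_tsum fun a => ENNReal.tsum_le_tsum fun c => ?_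
        calc _ ≤ u a * v c * (psiStar P X g * (P (U ⁻¹' {a}) * P (V ⁻¹' {c}))) := by
              gcongr; exact h1 a c
          _ = _ := by ring
    _ = _ := by
        simp only [ENNReal.tsum_mul_left, ENNReal.tsum_mul_right]

/-- Shift invariance of a stationary process. -/
lemma IsStationary.map_shift {P : Measure Ω} {X : ℕ → Ω → ℝ} (h : IsStationary P X)
    (hX : ∀ i, Measurable (X i)) (s : ℕ) :
    P.map (fun ω (i : ℕ) => X (i + s) ω) = P.map (fun ω (i : ℕ) => X i ω) := by
  induction s with
  | zero => rfl
  | succ s ih =>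
    have hsh : Measurable (fun (x : ℕ → ℝ) (i : ℕ) => x (i + s)) := by fun_prop
    rw [← ih, ← Function.comp_def (fun (x : ℕ → ℝ) (i : ℕ) => x (i + s)) (fun ω i => X i ω)]
    conv_rhs => rw [← Measure.map_map hsh (by fun_prop), ← h, Measure.map_map hsh (by fun_prop)]
    congr 1

/-! ### Quantized words and windows -/

lemma finite_quantizedAlphabet {𝒳 : Set ℝ} (h𝒳 : Bornology.IsBounded 𝒳) :
    ∃ K : ℕ, ∀ b, (quantizedAlphabet 𝒳 b).Finite ∧
      ENat.card (quantizedAlphabet 𝒳 b) ≤ ((K * 2 ^ b : ℕ) : ℕ∞) := by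
  obtain ⟨M, hM⟩ := h𝒳.exists_norm_le
  obtain ⟨R, hR⟩ := exists_nat_ge M
  -- If `𝒳 ⊆ [-R, R]`, the codes lie among `2R * 2^b + 2` integers. That `K` does not depend on `b`
  -- is essential for the second moment bound.
  refine ⟨2 * R + 2, fun b => ?_⟩
  let s : Finset ℤ := Finset.Icc (-(R * 2 ^ b : ℤ) - 1) (R * 2 ^ b : ℤ)
  have hsub : quantizedAlphabet 𝒳 b ⊆ (s.image fun z : ℤ => (z : ℝ) / 2 ^ b : Finset ℝ) := by
    rintro _ ⟨x, hx, rfl⟩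
    rw [Finset.mem_coe, Finset.mem_image]
    refine ⟨⌊(2 : ℝ) ^ b * x⌋, ?_, rfl⟩
    have hx1 : |x| ≤ R := (hM x hx).trans hR
    have h2 : (0 : ℝ) < 2 ^ b := by positivity
    have h3 : |(2 : ℝ) ^ b * x| ≤ R * 2 ^ b := by
      rw [abs_mul, abs_of_pos h2, mul_comm]; gcongr
    obtain ⟨h4, h5⟩ := abs_le.1 h3
    rw [Finset.mem_Icc]
    constructor
    · rw [Int.le_floor]; push_cast; linarith
    · have : (⌊(2 : ℝ) ^ b * x⌋ : ℝ) ≤ ((R * 2 ^ b : ℤ) : ℝ) := by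
        push_cast; exact (Int.floor_le _).trans h5
      exact_mod_cast this
  refine ⟨(Finset.finite_toSet _).subset hsub, ?_⟩
  calc ENat.card (quantizedAlphabet 𝒳 b)
      ≤ ENat.card ((s.image fun z : ℤ => (z : ℝ) / 2 ^ b : Finset ℝ) : Set ℝ) :=
        ENat.card_le_card_of_injective (Set.inclusion_injective hsub)
    _ = ((s.image fun z : ℤ => (z : ℝ) / 2 ^ b).card : ℕ∞) := by simp
    _ ≤ _ := by
        rw [Nat.cast_le]
        refine Finset.card_image_le.trans ?_
        rw [Int.card_Icc]
        have : 1 ≤ 2 ^ b := Nat.one_le_two_pow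
        have h6 : ((R : ℤ) * 2 ^ b + 1 - (-(R * 2 ^ b : ℤ) - 1)) = ((2 * R * 2 ^ b + 2 : ℕ) : ℤ) := by
          push_cast; ring
        rw [h6, Int.toNat_natCast]
        nlinarith

/-- Words of length `l` over the quantized alphabet. -/
abbrev Words (𝒳 : Set ℝ) (b l : ℕ) : Type := {a : Fin l → ℝ // ∀ i, a i ∈ quantizedAlphabet 𝒳 b}

lemma finite_words {𝒳 : Set ℝ} (h𝒳 : Bornology.IsBounded 𝒳) (b l : ℕ) : Finite (Words 𝒳 b l) := by
  obtain ⟨K, hK⟩ := finite_quantizedAlphabet h𝒳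
  exact (Set.Finite.pi' (fun _ : Fin l => (hK b).1)).to_subtype

/-- The integers `⌊2 ^ b X_i⌋, …, ⌊2 ^ b X_{i + k}⌋`. -/
def window (X : ℕ → Ω → ℝ) (b k i : ℕ) (ω : Ω) : Fin (k + 1) → ℤ :=
  fun j => ⌊(2 : ℝ) ^ b * X (i + j) ω⌋

/-- The quantized word with the given integer codes. -/
def decode (b : ℕ) {l : ℕ} (z : Fin l → ℤ) : Fin l → ℝ := fun j => (z j : ℝ) / 2 ^ b

lemma decode_window {Ω : Type*} (X : ℕ → Ω → ℝ) (b k i : ℕ) (ω : Ω) (j : Fin (k + 1)) :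
    decode b (window X b k i ω) j = quantize b (X (i + j) ω) := rfl

/-- The codes form a countable discrete space, so every functional of a window is measurable. The
σ-field is arbitrary so that past and future σ-fields are covered. -/
lemma measurable_window {Ω : Type*} {m : MeasurableSpace Ω} {X : ℕ → Ω → ℝ} {b k i : ℕ}
    (hX : ∀ j : Fin (k + 1), Measurable[m] (X (i + j))) : Measurable[m] (window X b k i) :=
  measurable_pi_iff.2 fun j => Int.measurable_floor.comp ((hX j).const_mul _)

lemma lintegral_window {P : Measure Ω} {X : ℕ → Ω → ℝ} (h : IsStationary P X)
    (hX : ∀ i, Measurable (X i)) (b k i : ℕ) (f : (Fin (k + 1) → ℤ) → ℝ≥0∞) :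
    ∫⁻ ω, f (window X b k i ω) ∂P = ∫⁻ ω, f (window X b k 0 ω) ∂P := by
  have hφ : Measurable (fun (x : ℕ → ℝ) => f (fun j : Fin (k + 1) => ⌊(2 : ℝ) ^ b * x j⌋)) :=
    (measurable_of_countable f).comp
      (measurable_pi_iff.2 fun j => Int.measurable_floor.comp ((measurable_pi_apply _).const_mul _))
  have h1 := lintegral_map (μ := P) hφ (g := fun ω (l : ℕ) => X (l + i) ω) (by fun_prop)
  have h2 := lintegral_map (μ := P) hφ (g := fun ω (l : ℕ) => X l ω) (by fun_prop)
  rw [h.map_shift hX i, h2] at h1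
  have hw : ∀ s ω, window X b k s ω = fun j : Fin (k + 1) => ⌊(2 : ℝ) ^ b * X (j + s) ω⌋ :=
    fun s ω => funext fun j => by rw [add_comm]; rfl
  simp only [hw]
  exact h1.symm

lemma tsum_ite_words {𝒳 : Set ℝ} {b l : ℕ} {w : Fin l → ℝ} (hw : ∀ i, w i ∈ quantizedAlphabet 𝒳 b)
    (f : (Fin l → ℝ) → ℝ≥0∞) [∀ a : Words 𝒳 b l, Decidable (w = a.1)] :
    ∑' a : Words 𝒳 b l, f a.1 * (if w = a.1 then 1 else 0) = f w := by
  rw [tsum_eq_single ⟨w, hw⟩]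
  · simp
  · intro a ha
    rw [if_neg, mul_zero]
    exact fun h => ha (Subtype.ext h.symm)

lemma tsum_blockProb_mul {P : Measure Ω} {X : ℕ → Ω → ℝ} {𝒳 : Set ℝ}
    (h𝒳 : Bornology.IsBounded 𝒳) (hX : ∀ i, Measurable (X i)) (hX_mem : ∀ i, ∀ᵐ ω ∂P, X i ω ∈ 𝒳)
    (b k : ℕ) (f : (Fin (k + 1) → ℝ) → ℝ≥0∞) :
    ∑' a : Words 𝒳 b (k + 1), blockProb P X b a.1 * f a.1
      = ∫⁻ ω, f (decode b (window X b k 0 ω)) ∂P := by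
  classical
  have := finite_words h𝒳 b (k + 1)
  have hw : Measurable (window X b k 0) := measurable_window fun j => hX _
  have h1 : ∀ a : Words 𝒳 b (k + 1), blockProb P X b a.1 * f a.1
      = ∫⁻ ω, f a.1 * (if decode b (window X b k 0 ω) = a.1 then 1 else 0) ∂P := by
    intro a
    have hms : MeasurableSet {ω | decode b (window X b k 0 ω) = a.1} :=
      hw (MeasurableSet.of_discrete (s := {z | decode b z = a.1}))
    have : ∀ ω, (if decode b (window X b k 0 ω) = a.1 then (1 : ℝ≥0∞) else 0)
        = {ω | decode b (window X b k 0 ω) = a.1}.indicator 1 ω := fun ω => by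
      simp [Set.indicator_apply]
    simp only [this]
    rw [lintegral_const_mul _ (measurable_one.indicator hms), lintegral_indicator_one hms, mul_comm]
    congr 1
    refine congrArg P (Set.ext fun ω => ?_)
    simp [funext_iff, decode_window]
  simp only [h1]
  rw [← lintegral_tsum]
  · refine lintegral_congr_ae ?_
    filter_upwards [ae_all_iff.2 hX_mem] with ω hω
    exact tsum_ite_words (fun j => ⟨_, hω _, (decode_window X b k 0 ω j).symm⟩) f
  · intro a
    exact ((measurable_of_countable (fun z : Fin (k + 1) → ℤ =>
      f a.1 * (if decode b z = a.1 then (1 : ℝ≥0∞) else 0))).comp hw).aemeasurable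

lemma condEntropy_eq_lintegral {P : Measure Ω} {X : ℕ → Ω → ℝ} {𝒳 : Set ℝ}
    (h𝒳 : Bornology.IsBounded 𝒳) (hX : ∀ i, Measurable (X i)) (hX_mem : ∀ i, ∀ᵐ ω ∂P, X i ω ∈ 𝒳)
    (b k : ℕ) :
    condEntropy P X 𝒳 k b = ∫⁻ ω, weight P X k b (decode b (window X b k 0 ω)) ∂P :=
  tsum_blockProb_mul h𝒳 hX hX_mem b k _

/-- The cost of the source block is thus an average along a stationary sequence, open to a law of
large numbers. -/
lemma cost_eq_sum {P : Measure Ω} {X : ℕ → Ω → ℝ} {𝒳 : Set ℝ} {b k n : ℕ} {ω : Ω}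
    (hω : ∀ i, X i ω ∈ 𝒳) :
    cost P X 𝒳 k b (WithLp.toLp 2 fun i : Fin n => quantize b (X i ω))
      = (∑ i ∈ Finset.range (n - k), weight P X k b (decode b (window X b k i ω)))
          / ((n - k : ℕ) : ℝ≥0∞) := by
  classical
  have h1 : ∀ a : Words 𝒳 b (k + 1),
      empDist k (WithLp.toLp 2 fun i : Fin n => quantize b (X i ω)) a.1
      = (∑ i ∈ Finset.range (n - k), if decode b (window X b k i ω) = a.1 then (1 : ℝ≥0∞) else 0)
        / ((n - k : ℕ) : ℝ≥0∞) := by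
    intro a
    rw [empDist]
    congr 1
    rw [Set.ncard_eq_toFinset_card', ← Fin.sum_univ_eq_sum_range
      (fun i => if decode b (window X b k i ω) = a.1 then (1 : ℝ≥0∞) else 0), Finset.sum_boole]
    congr 2
    ext i
    simp [funext_iff, decode_window]
  unfold cost
  simp only [h1, div_eq_mul_inv]
  simp only [← mul_assoc]
  rw [ENNReal.tsum_mul_right]
  congr 1
  simp only [Finset.mul_sum]
  rw [Summable.tsum_finsetSum fun _ _ => ENNReal.summable]
  exact Finset.sum_congr rfl fun i _ => tsum_ite_words
    (fun j => ⟨_, hω _, (decode_window X b k i ω j).symm⟩) (weight P X k b)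

/-! ### Second moment of the conditional information -/

lemma tsum_blockProb_init_le {P : Measure Ω} [IsProbabilityMeasure P] {X : ℕ → Ω → ℝ} {𝒳 : Set ℝ}
    (h𝒳 : Bornology.IsBounded 𝒳) (hX : ∀ i, Measurable (X i)) (b k : ℕ) :
    ∑' a : Words 𝒳 b (k + 1), blockProb P X b (Fin.init a.1 : Fin k → ℝ)
      ≤ ENat.card (quantizedAlphabet 𝒳 b) := by
  classical
  have := finite_words h𝒳 b (k + 1)
  have hq : ∀ i, Measurable fun ω => quantize b (X i ω) := fun i =>
    ((measurable_of_countable fun z : ℤ => (z : ℝ)).comp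
      (Int.measurable_floor.comp ((hX i).const_mul _))).div_const _
  have hms : ∀ a : Fin k → ℝ, MeasurableSet {ω | ∀ i : Fin k, quantize b (X i ω) = a i} := fun a =>
    by
      rw [Set.ofPred_forall]
      exact MeasurableSet.iInter fun i => hq i (measurableSet_singleton _)
  have h1 : ∀ a : Words 𝒳 b (k + 1), blockProb P X b (Fin.init a.1 : Fin k → ℝ)
      = ∫⁻ ω, {ω | ∀ i : Fin k, quantize b (X i ω) = (Fin.init a.1 : Fin k → ℝ) i}.indicator 1 ω ∂P :=
    fun a => by rw [lintegral_indicator_one (hms _)]; rfl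
  simp only [h1]
  rw [← lintegral_tsum fun a => (measurable_one.indicator (hms _)).aemeasurable]
  calc _ ≤ ∫⁻ _ω, (ENat.card (quantizedAlphabet 𝒳 b) : ℝ≥0∞) ∂P := by
        refine lintegral_mono fun ω => ?_
        let T : Set (Words 𝒳 b (k + 1)) :=
          {a | ∀ i : Fin k, quantize b (X i ω) = (Fin.init a.1 : Fin k → ℝ) i}
        calc _ = ∑' a : Words 𝒳 b (k + 1), T.indicator (fun _ => (1 : ℝ≥0∞)) a := rfl
          _ = ∑' _a : T, (1 : ℝ≥0∞) := (tsum_subtype T _).symm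
          -- For fixed `ω` the first `k` letters of the word are determined, so its last letter
          -- determines it.
          _ ≤ ∑' _x : quantizedAlphabet 𝒳 b, (1 : ℝ≥0∞) := by
              refine ENNReal.tsum_comp_le_tsum_of_injective
                (f := fun a : T => (⟨a.1.1 (Fin.last k), a.1.2 _⟩ : quantizedAlphabet 𝒳 b)) ?_
                (fun _ => (1 : ℝ≥0∞))
              rintro ⟨a, ha⟩ ⟨c, hc⟩ hac
              refine Subtype.ext (Subtype.ext (funext fun i => ?_))
              refine Fin.lastCases ?_ (fun i => ?_) i
              · exact congrArg Subtype.val hac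
              · exact (ha i).symm.trans (hc i)
          _ = _ := by rw [ENNReal.tsum_const, mul_one]
    _ = _ := by simp

/-- Beyond `l = b` the exponential `2^(l - b)` dominates `(l - b)²`. With `l = log(1/p)` the last
term is proportional to `1/p`, which a factor of probability can cancel. -/
lemma sq_le_two_mul_sq_add_rpow {l b : ℝ} (hl : 0 ≤ l) :
    l ^ 2 ≤ 2 * b ^ 2 + 10 * (2 : ℝ) ^ l / 2 ^ b := by
  rcases le_total l b with h | h
  · have h1 : 0 ≤ 10 * (2 : ℝ) ^ l / 2 ^ b := by positivity
    have h2 : l ^ 2 ≤ b ^ 2 := by gcongr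
    linarith [sq_nonneg b]
  · have hy : 0 ≤ l - b := sub_nonneg.2 h
    have h1 : (l - b) ^ 2 ≤ 5 * (2 : ℝ) ^ (l - b) := by
      rw [Real.rpow_def_of_pos two_pos]
      have h2 := Real.log_two_gt_d9
      have h3 := Real.quadratic_le_exp_of_nonneg (x := Real.log 2 * (l - b))
        (mul_nonneg (by linarith) hy)
      have h4 : 0.69 * (l - b) ≤ Real.log 2 * (l - b) := by gcongr; linarith
      have h5 : (0.69 * (l - b)) ^ 2 ≤ (Real.log 2 * (l - b)) ^ 2 := by gcongr
      nlinarith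
    rw [Real.rpow_sub two_pos] at h1
    have h6 : l ^ 2 ≤ 2 * b ^ 2 + 2 * (l - b) ^ 2 := by nlinarith [sq_nonneg (l - 2 * b)]
    calc _ ≤ _ := h6
      _ ≤ 2 * b ^ 2 + 2 * (5 * (2 ^ l / 2 ^ b)) := by gcongr
      _ = _ := by ring

lemma blockProb_le_init {P : Measure Ω} {X : ℕ → Ω → ℝ} {b k : ℕ} (a : Fin (k + 1) → ℝ) :
    blockProb P X b a ≤ blockProb P X b (Fin.init a : Fin k → ℝ) :=
  measure_mono fun _ hω i => hω i.castSucc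

/-- Here `2^l = 1/p` and `P(a)/p = P(init a)`. Summed over words these prefix probabilities give at
most the alphabet size `O(2^b)`, which the factor `2^(-b)` compensates. -/
lemma blockProb_mul_weight_sq_le {P : Measure Ω} [IsProbabilityMeasure P] {X : ℕ → Ω → ℝ}
    {b k : ℕ} (a : Fin (k + 1) → ℝ) :
    blockProb P X b a * weight P X k b a ^ 2 ≤
      blockProb P X b a * (2 * (b : ℝ≥0∞) ^ 2) +
        10 / 2 ^ b * blockProb P X b (Fin.init a : Fin k → ℝ) := by
  rcases eq_or_ne (blockProb P X b a) 0 with h0 | h0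
  · rw [h0, zero_mul]; exact zero_le
  have hle := blockProb_le_init (P := P) (X := X) (b := b) a
  have hi0 : blockProb P X b (Fin.init a : Fin k → ℝ) ≠ 0 := fun h => h0 (le_zero_iff.1 (h ▸ hle))
  have hit : blockProb P X b (Fin.init a : Fin k → ℝ) ≠ ∞ := measure_ne_top _ _
  have hat : blockProb P X b a ≠ ∞ := measure_ne_top _ _
  have hp0 : condProb P X k b a ≠ 0 := ENNReal.div_ne_zero.2 ⟨h0, hit⟩
  have hp1 : condProb P X k b a ≤ 1 := ENNReal.div_le_of_le_mul (by rwa [one_mul])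
  have hpt : condProb P X k b a ≠ ∞ := ne_top_of_le_ne_top ENNReal.one_ne_top hp1
  set p := condProb P X k b a with hp
  have hpr : 0 < p.toReal := ENNReal.toReal_pos hp0 hpt
  have hpr1 : p.toReal ≤ 1 := ENNReal.toReal_le_of_le_ofReal one_pos.le (by simpa using hp1)
  have hw : weight P X k b a = ENNReal.ofReal (Real.logb 2 (1 / p.toReal)) := if_neg hp0
  have hl : 0 ≤ Real.logb 2 (1 / p.toReal) :=
    Real.logb_nonneg one_lt_two (by rw [le_div_iff₀ hpr]; linarith)
  have h1 := sq_le_two_mul_sq_add_rpow (b := b) hl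
  rw [Real.rpow_logb two_pos (by norm_num) (by positivity)] at h1
  have h2 : weight P X k b a ^ 2 ≤ 2 * (b : ℝ≥0∞) ^ 2 + 10 / 2 ^ b * p⁻¹ := by
    rw [hw, ← ENNReal.ofReal_pow hl]
    refine (ENNReal.ofReal_le_ofReal h1).trans (le_of_eq ?_)
    rw [ENNReal.ofReal_add (by positivity) (by positivity), ENNReal.ofReal_mul (by norm_num),
      ENNReal.ofReal_pow (by positivity), ENNReal.ofReal_natCast, Real.rpow_natCast,
      mul_one_div, div_div, mul_comm p.toReal, ← div_div, div_eq_mul_inv _ p.toReal,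
      ENNReal.ofReal_mul (by positivity),
      ENNReal.ofReal_div_of_pos (by positivity), ENNReal.ofReal_inv_of_pos hpr,
      ENNReal.ofReal_toReal hpt, ENNReal.ofReal_pow (by norm_num)]
    simp
  calc _ ≤ blockProb P X b a * (2 * (b : ℝ≥0∞) ^ 2 + 10 / 2 ^ b * p⁻¹) := by gcongr
    _ = blockProb P X b a * (2 * (b : ℝ≥0∞) ^ 2) + 10 / 2 ^ b * (blockProb P X b a * p⁻¹) := by ring
    _ = _ := by
      congr 2
      rw [hp, condProb, ENNReal.inv_div (Or.inl hit) (Or.inl hi0), ENNReal.mul_div_cancel h0 hat]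

/-- The conditional information of a quantized window has second moment `O(b²)`. -/
lemma exists_lintegral_weight_sq_le {P : Measure Ω} [IsProbabilityMeasure P] {X : ℕ → Ω → ℝ}
    {𝒳 : Set ℝ} (h𝒳 : Bornology.IsBounded 𝒳) (hX : ∀ i, Measurable (X i))
    (hX_mem : ∀ i, ∀ᵐ ω ∂P, X i ω ∈ 𝒳) (k : ℕ) :
    ∃ C : ℝ≥0, ∀ b : ℕ, 1 ≤ b →
      ∫⁻ ω, weight P X k b (decode b (window X b k 0 ω)) ^ 2 ∂P ≤ C * (b : ℝ≥0∞) ^ 2 := by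
  obtain ⟨K, hK⟩ := finite_quantizedAlphabet h𝒳
  refine ⟨2 + 10 * K, fun b hb => ?_⟩
  have h1 := tsum_blockProb_mul (P := P) h𝒳 hX hX_mem b k (fun a => weight P X k b a ^ 2)
  have h2 := tsum_blockProb_mul (P := P) h𝒳 hX hX_mem b k (fun _ => 2 * (b : ℝ≥0∞) ^ 2)
  rw [lintegral_const, measure_univ, mul_one] at h2
  have h3 : (ENat.card (quantizedAlphabet 𝒳 b) : ℝ≥0∞) ≤ K * 2 ^ b := by
    have := ENat.toENNReal_le.2 (hK b).2
    simpa using this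
  have hb1 : (1 : ℝ≥0∞) ≤ (b : ℝ≥0∞) ^ 2 := one_le_pow₀ (by exact_mod_cast hb)
  rw [← h1]
  calc _ ≤ ∑' a : Words 𝒳 b (k + 1), (blockProb P X b a.1 * (2 * (b : ℝ≥0∞) ^ 2) +
        10 / 2 ^ b * blockProb P X b (Fin.init a.1 : Fin k → ℝ)) :=
        ENNReal.tsum_le_tsum fun a => blockProb_mul_weight_sq_le a.1
    _ ≤ 2 * (b : ℝ≥0∞) ^ 2 + 10 / 2 ^ b * (K * 2 ^ b) := by
        rw [ENNReal.tsum_add, h2, ENNReal.tsum_mul_left]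
        gcongr
        exact (tsum_blockProb_init_le h𝒳 hX b k).trans h3
    _ = 2 * (b : ℝ≥0∞) ^ 2 + 10 * K * 1 := by
        rw [mul_comm (K : ℝ≥0∞), ← mul_assoc, ENNReal.div_mul_cancel (by simp) (by simp), mul_one]
    _ ≤ 2 * (b : ℝ≥0∞) ^ 2 + 10 * K * (b : ℝ≥0∞) ^ 2 := by gcongr
    _ = _ := by push_cast; ring

/-! ### Law of large numbers for the cost -/

lemma two_mul_le_sq_add_sq (x y : ℝ≥0∞) : 2 * (x * y) ≤ x ^ 2 + y ^ 2 := by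
  rcases le_total x y with h | h <;> obtain ⟨d, rfl⟩ := exists_add_of_le h
  · calc _ ≤ 2 * (x * (x + d)) + d ^ 2 := le_self_add
      _ = _ := by ring
  · calc _ ≤ 2 * ((y + d) * y) + d ^ 2 := le_self_add
      _ = _ := by ring

/-- Second moment of the sum of a window functional of a `ψ*`-mixing process. -/
lemma lintegral_sum_window_sq_le {P : Measure Ω} [IsProbabilityMeasure P] {X : ℕ → Ω → ℝ}
    (hst : IsStationary P X) (hX : ∀ i, Measurable (X i)) (b k G N : ℕ)
    (f : (Fin (k + 1) → ℤ) → ℝ≥0∞) :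
    ∫⁻ ω, (∑ i ∈ Finset.range N, f (window X b k i ω)) ^ 2 ∂P ≤
      N ^ 2 * (psiStar P X G * (∫⁻ ω, f (window X b k 0 ω) ∂P) ^ 2) +
        N * (2 * (k + G : ℕ)) * ∫⁻ ω, f (window X b k 0 ω) ^ 2 ∂P := by
  have hw : ∀ i, Measurable (window X b k i) := fun i => measurable_window fun j => hX _
  have hf : ∀ i, Measurable fun ω => f (window X b k i ω) := fun i =>
    (measurable_of_countable f).comp (hw i)
  have hff : ∀ i j, Measurable fun ω => f (window X b k i ω) * f (window X b k j ω) := fun i j =>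
    (hf i).mul (hf j)
  set m1 := ∫⁻ ω, f (window X b k 0 ω) ∂P with hm1
  set m2 := ∫⁻ ω, f (window X b k 0 ω) ^ 2 ∂P with hm2
  have hfar : ∀ i j, i + (k + G) ≤ j →
      ∫⁻ ω, f (window X b k i ω) * f (window X b k j ω) ∂P ≤ psiStar P X G * m1 ^ 2 := by
    intro i j hij
    have h1 : Measurable[pastSigma X (i + k)] (window X b k i) := measurable_window fun l =>
      (comap_measurable (X (i + l))).mono
        (le_iSup₂_of_le (i + (l : ℕ)) (by omega) le_rfl) le_rfl
    have h2 : Measurable[futureSigma X (i + k + G)] (window X b k j) := measurable_window fun l =>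
      (comap_measurable (X (j + l))).mono
        (le_iSup₂_of_le (j + (l : ℕ)) (by omega) le_rfl) le_rfl
    have h3 := lintegral_mul_le_psiStar (P := P) (u := f) (v := f) hX h1 h2
    rwa [lintegral_window hst hX b k i, lintegral_window hst hX b k j, ← hm1, ← sq] at h3
  have hnear : ∀ i j, ∫⁻ ω, f (window X b k i ω) * f (window X b k j ω) ∂P ≤ m2 := by
    intro i j
    have h1 : 2 * ∫⁻ ω, f (window X b k i ω) * f (window X b k j ω) ∂P ≤ 2 * m2 := by
      rw [← lintegral_const_mul _ (hff i j)]
      calc _ ≤ ∫⁻ ω, f (window X b k i ω) ^ 2 + f (window X b k j ω) ^ 2 ∂P :=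
            lintegral_mono fun ω => two_mul_le_sq_add_sq _ _
        _ = _ := by
            rw [lintegral_add_left ((hf i).pow_const 2),
              lintegral_window hst hX b k i fun z => f z ^ 2,
              lintegral_window hst hX b k j fun z => f z ^ 2, two_mul]
    exact (ENNReal.mul_le_mul_iff_right (by simp) (by simp)).1 h1
  -- Pairs at distance at least `k + G` leave a gap of at least `G` between windows. The interval
  -- holds all other `j`; truncation at `0` does no harm.
  have hall : ∀ i j, ∫⁻ ω, f (window X b k i ω) * f (window X b k j ω) ∂P ≤
      psiStar P X G * m1 ^ 2 + if j ∈ Finset.Ico (i + 1 - (k + G)) (i + (k + G)) then m2 else 0 := by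
    intro i j
    split_ifs with h
    · exact (hnear i j).trans le_add_self
    · rw [add_zero]
      rw [Finset.mem_Ico, not_and_or, not_le, not_lt] at h
      rcases h with h | h
      · simp only [mul_comm (f (window X b k i _))]
        exact hfar j i (by omega)
      · exact hfar i j h
  have hcount : ∀ i, ∑ j ∈ Finset.range N,
      (if j ∈ Finset.Ico (i + 1 - (k + G)) (i + (k + G)) then m2 else 0) ≤
        (2 * (k + G : ℕ)) * m2 := by
    intro i
    rw [← Finset.sum_filter, Finset.sum_const, nsmul_eq_mul]
    gcongr
    have : ((Finset.range N).filter fun j =>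
        j ∈ Finset.Ico (i + 1 - (k + G)) (i + (k + G))).card ≤ 2 * (k + G) := by
      calc _ ≤ (Finset.Ico (i + 1 - (k + G)) (i + (k + G))).card :=
            Finset.card_le_card fun j hj => (Finset.mem_filter.1 hj).2
        _ ≤ _ := by rw [Nat.card_Ico]; omega
    exact_mod_cast this
  simp only [sq (∑ i ∈ Finset.range N, f _), Finset.sum_mul_sum]
  rw [lintegral_finsetSum _ fun i _ => Finset.measurable_fun_sum _ fun j _ => hff i j]
  calc _ = ∑ i ∈ Finset.range N, ∑ j ∈ Finset.range N,
        ∫⁻ ω, f (window X b k i ω) * f (window X b k j ω) ∂P :=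
        Finset.sum_congr rfl fun i _ => lintegral_finsetSum _ fun j _ => hff i j
    _ ≤ ∑ i ∈ Finset.range N, ∑ j ∈ Finset.range N, (psiStar P X G * m1 ^ 2 +
        if j ∈ Finset.Ico (i + 1 - (k + G)) (i + (k + G)) then m2 else 0) :=
        Finset.sum_le_sum fun i _ => Finset.sum_le_sum fun j _ => hall i j
    _ ≤ ∑ _i ∈ Finset.range N, (N * (psiStar P X G * m1 ^ 2) + (2 * (k + G : ℕ)) * m2) := by
        refine Finset.sum_le_sum fun i _ => ?_
        rw [Finset.sum_add_distrib]
        gcongr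
        · simp
        · exact hcount i
    _ = _ := by
        rw [Finset.sum_const, Finset.card_range, nsmul_eq_mul]
        ring

/-- The mean is finite since `V ≤ 1 + V²`; the inequality is then Chebyshev's
`sq_mul_meas_add_sq_le` at `t = 0`. -/
lemma lintegral_sq_le {P : Measure Ω} [IsProbabilityMeasure P] {V : Ω → ℝ≥0∞} (hV : Measurable V)
    (h2 : ∫⁻ ω, V ω ^ 2 ∂P ≠ ∞) :
    ∫⁻ ω, V ω ∂P ≠ ∞ ∧ (∫⁻ ω, V ω ∂P) ^ 2 ≤ ∫⁻ ω, V ω ^ 2 ∂P := by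
  have hfin : ∫⁻ ω, V ω ∂P ≠ ∞ := by
    have h1 : ∫⁻ ω, V ω ∂P ≤ ∫⁻ ω, (1 + V ω ^ 2) ∂P := by
      refine lintegral_mono fun ω => ?_
      rcases le_total (V ω) 1 with h | h
      · exact h.trans le_self_add
      · exact (le_self_pow h two_ne_zero).trans le_add_self
    rw [lintegral_add_left measurable_const, lintegral_const, measure_univ, mul_one] at h1
    exact ne_top_of_le_ne_top (ENNReal.add_ne_top.2 ⟨ENNReal.one_ne_top, h2⟩) h1
  have := sq_mul_meas_add_sq_le hV hfin 0
  simp at this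
  exact ⟨hfin, this⟩

/-- The quantized source block is feasible with probability tending to one. -/
lemma tendsto_prob_notMem_feasibleSet {P : Measure Ω} [IsProbabilityMeasure P] {𝒳 : Set ℝ}
    (h𝒳 : Bornology.IsBounded 𝒳) {X : ℕ → Ω → ℝ} (hX : ∀ i, Measurable (X i))
    (hX_mem : ∀ i, ∀ᵐ ω ∂P, X i ω ∈ 𝒳) (hmix : IsPsiStarMixing P X) (k : ℕ) {δ : ℝ} (hδ : 0 < δ)
    {b : ℕ → ℕ} (hb : Tendsto b atTop atTop) :
    Tendsto (fun n => P {ω | WithLp.toLp 2 (fun i : Fin n => quantize (b n) (X i ω)) ∉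
      feasibleSet P X 𝒳 k (b n) n (b n * (upperInfoDim P X 𝒳 k + δ))}) atTop (𝓝 0) := by
  obtain ⟨C, hC⟩ := exists_lintegral_weight_sq_le (P := P) h𝒳 hX hX_mem k
  have hV : ∀ b i, Measurable fun ω => weight P X k b (decode b (window X b k i ω)) := fun b i =>
    (measurable_of_countable fun z => weight P X k b (decode b z)).comp
      (measurable_window fun j => hX _)
  have hCt : ∀ b : ℕ, (C : ℝ≥0∞) * (b : ℝ≥0∞) ^ 2 ≠ ∞ := fun b =>
    ENNReal.mul_ne_top (by simp) (ENNReal.pow_ne_top (by simp))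
  have hE : ∀ b : ℕ, 1 ≤ b → condEntropy P X 𝒳 k b ≠ ∞ ∧
      condEntropy P X 𝒳 k b ^ 2 ≤ C * (b : ℝ≥0∞) ^ 2 := by
    intro b hb
    rw [condEntropy_eq_lintegral h𝒳 hX hX_mem]
    have := lintegral_sq_le (hV b 0) (ne_top_of_le_ne_top (hCt b) (hC b hb))
    exact ⟨this.1, this.2.trans (hC b hb)⟩
  set L := limsup (fun b : ℕ => condEntropy P X 𝒳 k b / (b : ℝ≥0∞)) atTop with hL
  -- Ensures that `toReal` in `upperInfoDim` does not return its default value `0`.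
  have hLt : L ≠ ∞ := by
    have : L ≤ C + 1 := by
      refine limsup_le_of_le (by isBoundedDefault) ?_
      filter_upwards [eventually_ge_atTop 1] with b hb
      refine ENNReal.div_le_of_le_mul ((ENNReal.pow_le_pow_left_iff two_ne_zero).1 ?_)
      refine (hE b hb).2.trans ?_
      rw [mul_pow]
      gcongr
      calc (C : ℝ≥0∞) ≤ C + (C ^ 2 + C + 1) := le_self_add
        _ = _ := by ring
    exact ne_top_of_le_ne_top (by simp) this
  set d := upperInfoDim P X 𝒳 k with hd
  have hd0 : 0 ≤ d := ENNReal.toReal_nonneg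
  have hLd : L = ENNReal.ofReal d := (ENNReal.ofReal_toReal hLt).symm
  have hent : ∀ᶠ b : ℕ in atTop,
      condEntropy P X 𝒳 k b ≤ (b : ℝ≥0∞) * ENNReal.ofReal (d + δ / 2) := by
    have h1 : L < ENNReal.ofReal (d + δ / 2) := by
      rw [hLd, ENNReal.ofReal_lt_ofReal_iff (by positivity)]; linarith
    filter_upwards [eventually_lt_of_limsup_lt h1, eventually_ge_atTop 1] with b h2 h3
    rw [mul_comm]
    exact ((ENNReal.div_le_iff (by simp; omega) (by simp)).1 h2.le)
  rw [ENNReal.tendsto_nhds_zero]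
  intro ε hε
  obtain ⟨e, he0, heε⟩ := ENNReal.lt_iff_exists_nnreal_btwn.1 hε
  have he : (0 : ℝ) < e := by exact_mod_cast he0
  -- Mixing and close pairs will each add at most `ηCB²` to the variance of the average. The
  -- deviation allowed is `τ = Bδ/2`, so the failure probability is at most `2ηCB²/τ² = 8ηC/δ²`.
  obtain ⟨η, hη, hηe⟩ : ∃ η : ℝ, 0 < η ∧ 8 * η * C / δ ^ 2 ≤ e := by
    refine ⟨e * δ ^ 2 / (8 * (C + 1)), by positivity, ?_⟩
    rw [div_le_iff₀ (by positivity)]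
    have : 8 * (e * δ ^ 2 / (8 * (C + 1))) * C = e * δ ^ 2 * (C / (C + 1) : ℝ) := by field_simp
    rw [this]
    refine mul_le_of_le_one_right (by positivity) ?_
    rw [div_le_one (by positivity)]
    linarith
  -- `ψ*` refers to the unquantized process, so `G` is fixed while `b n` grows.
  obtain ⟨G, hG⟩ : ∃ G, psiStar P X G ≤ ENNReal.ofReal (1 + η) := by
    have h1 : (1 : ℝ≥0∞) < ENNReal.ofReal (1 + η) := by
      rw [← ENNReal.ofReal_one, ENNReal.ofReal_lt_ofReal_iff (by positivity)]; linarith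
    exact ((hmix.tendsto_psiStar.eventually_lt_const h1).exists).imp fun _ h => h.le
  have hlarge : ∀ᶠ n : ℕ in atTop, 2 * ((k + G : ℕ) : ℝ) / η ≤ ((n - k : ℕ) : ℝ) :=
    (tendsto_natCast_atTop_atTop.comp (tendsto_sub_atTop_nat k)).eventually_ge_atTop _
  filter_upwards [hlarge, eventually_gt_atTop k, hb.eventually hent,
    hb.eventually_ge_atTop 1] with n hn hnk hen hb1
  refine le_trans ?_ heε.le
  set N := n - k with hN
  have hN0 : 0 < N := by omega
  have hNr : (0 : ℝ) < N := by exact_mod_cast hN0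
  have hbr : (0 : ℝ) < b n := by exact_mod_cast hb1
  set B := b n with hB
  set S : Ω → ℝ≥0∞ := fun ω =>
    ∑ i ∈ Finset.range N, weight P X k B (decode B (window X B k i ω)) with hS
  have hSm : Measurable S := Finset.measurable_fun_sum _ fun i _ => hV B i
  set m1 := condEntropy P X 𝒳 k B with hm1
  have hm1eq := condEntropy_eq_lintegral (P := P) h𝒳 hX hX_mem B k
  have hSint : ∫⁻ ω, S ω ∂P = N * m1 := by
    rw [hS, lintegral_finsetSum _ fun i _ => hV B i]
    simp only [lintegral_window hmix.stationary hX B k _ fun z => weight P X k B (decode B z)]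
    rw [Finset.sum_const, Finset.card_range, nsmul_eq_mul, hm1, hm1eq]
  have hm1t : m1 ≠ ∞ := (hE B hb1).1
  set τ : ℝ := B * δ / 2 with hτ
  have hτ0 : 0 < τ := by positivity
  have hsub : {ω | WithLp.toLp 2 (fun i : Fin n => quantize B (X i ω)) ∉
      feasibleSet P X 𝒳 k B n (B * (d + δ))} ≤ᵐ[P]
      {ω | ∫⁻ ω, S ω ∂P + N * ENNReal.ofReal τ ≤ S ω} := by
    filter_upwards [ae_all_iff.2 hX_mem] with ω hω hbad
    by_contra hcon
    have hlt : S ω < ∫⁻ ω, S ω ∂P + N * ENNReal.ofReal τ := not_le.1 hcon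
    refine hbad ⟨fun i => ⟨_, hω i, rfl⟩, ?_⟩
    rw [cost_eq_sum hω]
    refine ENNReal.div_le_of_le_mul (hlt.le.trans ?_)
    rw [hSint, ← mul_add, mul_comm]
    gcongr
    calc m1 + ENNReal.ofReal τ ≤ B * ENNReal.ofReal (d + δ / 2) + ENNReal.ofReal τ := by gcongr
      _ = ENNReal.ofReal (B * (d + δ)) := by
        rw [← ENNReal.ofReal_natCast, ← ENNReal.ofReal_mul (by positivity),
          ← ENNReal.ofReal_add (by positivity) (by positivity)]
        congr 1
        rw [hτ]; ring
  refine (measure_mono_ae hsub).trans ?_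
  have hcheb := (sq_mul_meas_add_sq_le hSm (by rw [hSint]; exact ENNReal.mul_ne_top (by simp) hm1t)
    (N * ENNReal.ofReal τ)).trans (lintegral_sum_window_sq_le hmix.stationary hX B k G N
      fun z => weight P X k B (decode B z))
  set p := P {ω | ∫⁻ ω, S ω ∂P + N * ENNReal.ofReal τ ≤ S ω} with hp
  have hpt : p ≠ ∞ := measure_ne_top _ _
  rw [hSint, ← hm1eq, ← hm1] at hcheb
  have hcheb2 : (N * ENNReal.ofReal τ) ^ 2 * p + (N * m1) ^ 2 ≤
      N ^ 2 * (ENNReal.ofReal (1 + η) * m1 ^ 2) + N * (2 * (k + G : ℕ)) * (C * (B : ℝ≥0∞) ^ 2) := by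
    refine hcheb.trans ?_
    gcongr
    exact hC B hb1
  have hreal := ENNReal.toReal_mono (by
    refine ENNReal.add_ne_top.2 ⟨?_, ?_⟩
    · exact ENNReal.mul_ne_top (by simp) (ENNReal.mul_ne_top (by simp) (ENNReal.pow_ne_top hm1t))
    · exact ENNReal.mul_ne_top (ENNReal.mul_ne_top (by simp)
        (ENNReal.mul_ne_top (by simp) (by simp))) (hCt B)) hcheb2
  rw [ENNReal.toReal_add (ENNReal.mul_ne_top (ENNReal.pow_ne_top (by finiteness)) hpt)
      (ENNReal.pow_ne_top (ENNReal.mul_ne_top (by simp) hm1t)),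
    ENNReal.toReal_add (ENNReal.mul_ne_top (by simp)
      (ENNReal.mul_ne_top (by simp) (ENNReal.pow_ne_top hm1t)))
      (ENNReal.mul_ne_top (by finiteness) (hCt B))] at hreal
  simp only [ENNReal.toReal_mul, ENNReal.toReal_pow, ENNReal.toReal_natCast,
    ENNReal.toReal_ofReal hτ0.le, ENNReal.toReal_ofReal (show (0 : ℝ) ≤ 1 + η by positivity),
    ENNReal.coe_toReal, ENNReal.toReal_ofNat] at hreal
  have hM : m1.toReal ^ 2 ≤ C * (B : ℝ) ^ 2 := by
    have := ENNReal.toReal_mono (hCt B) (hE B hb1).2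
    simpa using this
  rw [div_le_iff₀ hη] at hn
  have h1 : τ ^ 2 * p.toReal ≤ 2 * η * C * (B : ℝ) ^ 2 := by
    have h2 : (N : ℝ) * (2 * ((k + G : ℕ) : ℝ)) * (C * (B : ℝ) ^ 2) ≤
        N * (N * η) * (C * (B : ℝ) ^ 2) := by gcongr
    have h3 : (N : ℝ) ^ 2 * (η * m1.toReal ^ 2) ≤ N ^ 2 * (η * (C * (B : ℝ) ^ 2)) := by gcongr
    have h4 : (N : ℝ) ^ 2 * (τ ^ 2 * p.toReal) ≤ N ^ 2 * (2 * η * C * (B : ℝ) ^ 2) := by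
      nlinarith
    exact le_of_mul_le_mul_left h4 (by positivity)
  have h5 : p.toReal ≤ e := by
    refine le_trans ?_ hηe
    rw [le_div_iff₀ (by positivity)]
    have h6 : (B : ℝ) ^ 2 * (p.toReal * δ ^ 2) ≤ B ^ 2 * (8 * η * C) := by
      rw [hτ] at h1; nlinarith
    exact le_of_mul_le_mul_left h6 (by positivity)
  rw [← ENNReal.ofReal_coe_nnreal]
  exact (ENNReal.le_ofReal_iff_toReal_le hpt e.2).2 h5

/-! ### Quantization error and noise -/

lemma norm_sub_quantize_le (n b : ℕ) (x : Fin n → ℝ) :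
    ‖WithLp.toLp 2 x - WithLp.toLp 2 (fun i => quantize b (x i))‖ ≤ √n * 2 ^ (-(b : ℝ)) := by
  have hq : ∀ y : ℝ, |y - quantize b y| ≤ ((2 : ℝ) ^ b)⁻¹ := by
    intro y
    have h2 : (0 : ℝ) < 2 ^ b := by positivity
    have h1 : y - quantize b y = Int.fract ((2 : ℝ) ^ b * y) * ((2 : ℝ) ^ b)⁻¹ := by
      rw [quantize, Int.fract]
      field_simp
    rw [h1, abs_of_nonneg (mul_nonneg (Int.fract_nonneg _) (by positivity))]
    exact mul_le_of_le_one_left (by positivity) (Int.fract_lt_one _).le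
  rw [Real.rpow_neg two_pos.le, Real.rpow_natCast]
  refine le_of_sq_le_sq ?_ (by positivity)
  rw [EuclideanSpace.real_norm_sq_eq, mul_pow, Real.sq_sqrt (Nat.cast_nonneg _)]
  calc _ ≤ ∑ _i : Fin n, (((2 : ℝ) ^ b)⁻¹) ^ 2 := by
        refine Finset.sum_le_sum fun i _ => ?_
        rw [← sq_abs]
        gcongr
        exact hq (x i)
    _ = _ := by simp

/-- Markov's inequality for `‖Aᵀ Z‖²`. -/
lemma prob_norm_transpose_mulVec_le {m n : ℕ} (hm : 0 < m) (hn : 0 < n) {P : Measure Ω}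
    [IsProbabilityMeasure P] {A : Fin m → Fin n → Ω → ℝ} {Z : Fin m → Ω → ℝ} {σ : ℝ≥0}
    (hA : ∀ i j, HasLaw (A i j) (gaussianReal 0 1) P)
    (hZ : ∀ i, HasLaw (Z i) (gaussianReal 0 (σ ^ 2)) P) (hZi : iIndepFun Z P)
    (hAZ : IndepFun (fun ω i j => A i j ω) (fun ω i => Z i ω) P) {c : ℝ} (hc : 0 < c) :
    P {ω | σ / 4 * √(c * m * n) <
      ‖WithLp.toLp 2 ((Matrix.of fun i j => A i j ω)ᵀ *ᵥ fun i => Z i ω)‖} ≤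
      ENNReal.ofReal (16 / c) := by
  obtain ⟨hI, hE⟩ := integral_sq_norm_transpose_mulVec hA hZ hZi hAZ
  rw [Fintype.card_fin, Fintype.card_fin] at hE
  set W : Ω → ℝ := fun ω => ∑ j, (∑ i, A i j ω * Z i ω) ^ 2 with hW
  have hW0 : 0 ≤ W := fun ω => Finset.sum_nonneg fun _ _ => sq_nonneg _
  have hnorm : ∀ ω, ‖WithLp.toLp 2 ((Matrix.of fun i j => A i j ω)ᵀ *ᵥ fun i => Z i ω)‖ ^ 2
      = W ω := by
    intro ω
    rw [EuclideanSpace.real_norm_sq_eq]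
    simp [hW, Matrix.mulVec, dotProduct]
  have hm0 : (0 : ℝ) < m := by exact_mod_cast hm
  have hn0 : (0 : ℝ) < n := by exact_mod_cast hn
  set θ : ℝ := σ ^ 2 / 16 * (c * m * n) with hθ
  have hsub : {ω | σ / 4 * √(c * m * n) <
      ‖WithLp.toLp 2 ((Matrix.of fun i j => A i j ω)ᵀ *ᵥ fun i => Z i ω)‖} ⊆ {ω | θ < W ω} := by
    intro ω hω
    have h1 : σ / 4 * √(c * m * n) <
      ‖WithLp.toLp 2 ((Matrix.of fun i j => A i j ω)ᵀ *ᵥ fun i => Z i ω)‖ := hω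
    have h2 := pow_lt_pow_left₀ h1 (by positivity) two_ne_zero
    rw [hnorm, mul_pow, Real.sq_sqrt (by positivity)] at h2
    change θ < W ω
    rw [hθ]
    linarith
  refine (measure_mono hsub).trans ?_
  -- For `σ = 0` the threshold `θ` is `0` and Markov's inequality is void, but `W` has zero
  -- integral.
  rcases eq_or_ne σ 0 with rfl | hσ
  · have hz : W =ᵐ[P] 0 := (integral_eq_zero_iff_of_nonneg hW0 hI).1 (by rw [hE]; simp)
    have : P {ω | θ < W ω} = 0 := by
      refine measure_mono_null (t := {ω | ¬ W ω = 0}) (fun ω hω => ?_) hz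
      have h1 : θ < W ω := hω
      have h2 : θ = 0 := by simp [hθ]
      exact (h2 ▸ h1).ne'
    rw [this]
    exact zero_le
  · have hσ0 : (0 : ℝ) < σ := by positivity
    have hθ0 : 0 < θ := by positivity
    have hmk := mul_meas_ge_le_integral_of_nonneg (Eventually.of_forall hW0) hI θ
    rw [hE] at hmk
    refine (measure_mono (t := {ω | θ ≤ W ω}) fun ω (hω : θ < W ω) => hω.le).trans ?_
    refine (ENNReal.le_ofReal_iff_toReal_le (measure_ne_top _ _) (by positivity)).2 ?_
    rw [measureReal_def] at hmk
    rw [le_div_iff₀ hc]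
    have h3 : (σ ^ 2 * m * n : ℝ) * ((P {ω | θ ≤ W ω}).toReal * c) ≤ (σ ^ 2 * m * n) * 16 := by
      rw [hθ] at hmk ⊢
      nlinarith
    exact le_of_mul_le_mul_left h3 (by positivity)

end QMAP

end

/-! ### Assembly -/

open QMAP in
theorem mainTheorem3 {Ω : Type*} [MeasurableSpace Ω] (P : Measure Ω) [IsProbabilityMeasure P]
    -- the source: a `ψ*`-mixing process with values in the bounded set `𝒳`
    (𝒳 : Set ℝ) (h𝒳 : Bornology.IsBounded 𝒳)
    (X : ℕ → Ω → ℝ) (hX_meas : ∀ i, Measurable (X i)) (hX_mem : ∀ i, ∀ᵐ ω ∂P, X i ω ∈ 𝒳)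
    (hX_mix : IsPsiStarMixing P X)
    (k : ℕ)
    (hX_dens : ∃ f : ℝ≥0, 0 < f ∧ ∀ S : Set (Fin (k + 1) → ℝ), MeasurableSet S →
      S ⊆ {x | ∀ i, x i ∈ 𝒳} → 0 < P {ω | (fun i : Fin (k + 1) => X i ω) ∈ S} →
      (f : ℝ≥0∞) * volume S ≤ P {ω | (fun i : Fin (k + 1) => X i ω) ∈ S})
    -- the parameters
    (r δ : ℝ) (hr : 1 < r) (hδ : 0 < δ) (σ : ℝ≥0)
    (b m : ℕ → ℕ) (hb : ∀ n, b n = ⌈r * Real.logb 2 (Real.logb 2 n)⌉₊)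
    (hm : ∀ n, m n = ⌈80 * n * b n * (upperInfoDim P X 𝒳 k + δ)⌉₊)
    -- the design matrices and the noise vectors
    (A : (n : ℕ) → Fin (m n) → Fin n → Ω → ℝ)
    (hA_law : ∀ n i j, HasLaw (A n i j) (gaussianReal 0 1) P)
    (hA_indep : ∀ n, iIndepFun (fun p : Fin (m n) × Fin n => A n p.1 p.2) P)
    (Z : (n : ℕ) → Fin (m n) → Ω → ℝ)
    (hZ_law : ∀ n i, HasLaw (Z n i) (gaussianReal 0 (σ ^ 2)) P)
    (hZ_indep : ∀ n, iIndepFun (Z n) P)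
    (hAZ_indep : ∀ n, IndepFun (fun ω i j => A n i j ω) (fun ω i => Z n i ω) P)
    (hX_indep : ∀ n, IndepFun (fun ω (i : ℕ) => X i ω)
      (fun ω => ((fun i j => A n i j ω), (fun i => Z n i ω))) P) :
    -- the constraint set is eventually nonempty, so that the algorithm is well defined
    (∀ᶠ n in atTop,
      (feasibleSet P X 𝒳 k (b n) n (b n * (upperInfoDim P X 𝒳 k + δ))).Nonempty) ∧
    -- the probability that some run of the algorithm violates the bound at some step tends to `0`
    Tendsto (fun n => P {ω | ¬ ∀ x : ℕ → EuclideanSpace ℝ (Fin n),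
      IsPGD (Matrix.of fun i j => A n i j ω)
        ((Matrix.of fun i j => A n i j ω) *ᵥ (fun i : Fin n => X i ω) + fun i => Z n i ω)
        (1 / m n) (feasibleSet P X 𝒳 k (b n) n (b n * (upperInfoDim P X 𝒳 k + δ))) x →
      ∀ t : ℕ, 1 ≤ t →
        ‖x (t + 1) - WithLp.toLp 2 (fun i : Fin n => quantize (b n) (X i ω))‖ / √n ≤
          0.9 * (‖x t - WithLp.toLp 2 (fun i : Fin n => quantize (b n) (X i ω))‖ / √n) +
          2 * (2 + √((n : ℝ) / m n)) ^ 2 * 2 ^ (-(b n : ℝ)) +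
          σ / 2 * √(b n * (upperInfoDim P X 𝒳 k + 3 * δ) / m n)}) atTop (𝓝 0) := by
  have hd0 : 0 ≤ upperInfoDim P X 𝒳 k := ENNReal.toReal_nonneg
  set d := upperInfoDim P X 𝒳 k with hd
  have hbt : Tendsto b atTop atTop := by
    have h1 : Tendsto (fun n : ℕ => r * Real.logb 2 (Real.logb 2 n)) atTop atTop :=
      ((Real.tendsto_logb_atTop one_lt_two).comp ((Real.tendsto_logb_atTop one_lt_two).comp
        tendsto_natCast_atTop_atTop)).const_mul_atTop (by linarith)
    exact (tendsto_nat_ceil_atTop.comp h1).congr fun n => (hb n).symm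
  have hfeas := tendsto_prob_notMem_feasibleSet h𝒳 hX_meas hX_mem hX_mix k hδ hbt
  rw [← hd] at hfeas
  have hbR : Tendsto (fun n => (b n : ℝ)) atTop atTop := tendsto_natCast_atTop_atTop.comp hbt
  -- `4000 = 80 * 50`, once `b δ ≥ 50`. Then `m/800 ≥ 5n` beats the net cost `25^n ≤ e^(4n)` and
  -- leaves `e^(-n)`.
  have hm_large : ∀ᶠ n : ℕ in atTop, 4000 * n ≤ m n := by
    filter_upwards [hbR.eventually_ge_atTop (50 / δ)] with n hn
    rw [div_le_iff₀ hδ] at hn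
    have h1 : (4000 * n : ℝ) ≤ m n := by
      rw [hm n]
      refine le_trans ?_ (Nat.le_ceil _)
      have h2 : 50 ≤ b n * (d + δ) := by
        rw [mul_add]; exact hn.trans (le_add_of_nonneg_left (by positivity))
      calc (4000 * n : ℝ) = 80 * n * 50 := by ring
        _ ≤ 80 * n * (b n * (d + δ)) := by gcongr
        _ = _ := by ring
    exact_mod_cast h1
  constructor
  -- An empty constraint set would make the infeasibility event have probability `1`.
  · filter_upwards [hfeas.eventually_lt_const (zero_lt_one)] with n hn
    by_contra hne
    rw [Set.not_nonempty_iff_eq_empty] at hne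
    simp [hne] at hn
  have hiso : Tendsto (fun n => P {ω | ¬ NearIsometry (Matrix.of fun i j => A n i j ω)
      (1 / m n)}) atTop (𝓝 0) := by
    have hlim : Tendsto (fun n : ℕ => ENNReal.ofReal (4 * Real.exp (-(n : ℝ)))) atTop (𝓝 0) := by
      have h1 : Tendsto (fun n : ℕ => 4 * Real.exp (-(n : ℝ))) atTop (𝓝 (4 * 0)) :=
        (Real.tendsto_exp_neg_atTop_nhds_zero.comp tendsto_natCast_atTop_atTop).const_mul _
      simpa using ENNReal.tendsto_ofReal h1
    refine tendsto_of_tendsto_of_tendsto_of_le_of_le' tendsto_const_nhds hlim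
      (Eventually.of_forall fun _ => zero_le) ?_
    filter_upwards [hm_large, eventually_gt_atTop 0] with n hn hn0
    refine (prob_not_nearIsometry_le (by omega) (hA_law n) (hA_indep n)).trans
      (ENNReal.ofReal_le_ofReal ?_)
    have h25 : (25 : ℝ) ^ n ≤ Real.exp (4 * n) := by
      rw [mul_comm, Real.exp_nat_mul]
      gcongr
      have := Real.exp_one_gt_d9
      calc (25 : ℝ) ≤ 2.7 ^ 4 := by norm_num
        _ ≤ Real.exp 1 ^ 4 := by gcongr; linarith
        _ = Real.exp 4 := by rw [← Real.exp_nat_mul]; norm_num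
    have hn' : (4000 * n : ℝ) ≤ m n := by exact_mod_cast hn
    calc _ ≤ 4 * Real.exp (4 * n) * Real.exp (-(m n / 800)) := by gcongr
      _ = 4 * Real.exp (4 * n + -(m n / 800)) := by rw [mul_assoc, ← Real.exp_add]
      _ ≤ _ := by gcongr; linarith
  -- The threshold is chosen so that `2μ` times it equals `√n` times the noise term of the claim;
  -- its failure probability is `O(1/b)`.
  have hnoise : Tendsto (fun n => P {ω | σ / 4 * √(b n * (d + 3 * δ) * m n * n) <
      ‖WithLp.toLp 2 ((Matrix.of fun i j => A n i j ω)ᵀ *ᵥ fun i => Z n i ω)‖}) atTop (𝓝 0) := by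
    have hlim : Tendsto (fun n : ℕ => ENNReal.ofReal (16 / (b n * (d + 3 * δ)))) atTop (𝓝 0) := by
      have h1 : Tendsto (fun n : ℕ => 16 / (b n * (d + 3 * δ))) atTop (𝓝 0) :=
        (hbR.atTop_mul_const (by positivity)).const_div_atTop 16
      simpa using ENNReal.tendsto_ofReal h1
    refine tendsto_of_tendsto_of_tendsto_of_le_of_le' tendsto_const_nhds hlim
      (Eventually.of_forall fun _ => zero_le) ?_
    filter_upwards [hm_large, eventually_gt_atTop 0, hbt.eventually_gt_atTop 0] with n hn hn0 hbn
    have hbn' : (0 : ℝ) < b n := by exact_mod_cast hbn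
    exact prob_norm_transpose_mulVec_le (by omega) hn0 (hA_law n) (hZ_law n) (hZ_indep n)
      (hAZ_indep n) (by positivity)
  have hsum := (hfeas.add hiso).add hnoise
  simp only [add_zero] at hsum
  refine tendsto_of_tendsto_of_tendsto_of_le_of_le' tendsto_const_nhds hsum
    (Eventually.of_forall fun _ => zero_le) ?_
  filter_upwards [hm_large, eventually_gt_atTop 0] with n hn hn0
  refine le_trans (measure_mono fun ω hω => ?_)
    ((measure_union_le _ _).trans (add_le_add_left (measure_union_le _ _) _))
  -- Off the three bad events the estimate is deterministic, so it holds for all runs and all `t` at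
  -- once.
  by_contra hcon
  simp only [Set.mem_union, Set.mem_ofPred_eq, not_or, not_not, not_lt] at hcon
  obtain ⟨⟨hF, hI⟩, hN⟩ := hcon
  refine hω fun x hx t _ => ?_
  have hmr : (0 : ℝ) < m n := by exact_mod_cast (show 0 < m n by omega)
  have hnr : (0 : ℝ) < n := by exact_mod_cast hn0
  have hstep := pgd_step (ξ := WithLp.toLp 2 fun i : Fin n => X i ω) (by positivity) hI hF
    (hx.2 t).2
  set N1 := ‖x (t + 1) - WithLp.toLp 2 (fun i : Fin n => quantize (b n) (X i ω))‖
  set N0 := ‖x t - WithLp.toLp 2 (fun i : Fin n => quantize (b n) (X i ω))‖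
  have hquant := norm_sub_quantize_le n (b n) fun i : Fin n => X i ω
  have hs : 0 < √(n : ℝ) := Real.sqrt_pos.2 hnr
  have hT : 2 * (1 / (m n : ℝ) * (σ / 4 * √(b n * (d + 3 * δ) * m n * n)))
      = σ / 2 * √(b n * (d + 3 * δ) / m n) * √n := by
    have h1 : (b n * (d + 3 * δ) * m n * n : ℝ) = (b n * (d + 3 * δ) / m n) * n * m n ^ 2 := by
      field_simp
    rw [h1, Real.sqrt_mul (by positivity), Real.sqrt_mul (by positivity), Real.sqrt_sq hmr.le]
    field_simp
    ring
  have hN' : 2 * (1 / (m n : ℝ) *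
      ‖WithLp.toLp 2 ((Matrix.of fun i j => A n i j ω)ᵀ *ᵥ fun i => Z n i ω)‖)
      ≤ σ / 2 * √(b n * (d + 3 * δ) / m n) * √n := by
    rw [← hT]; gcongr
  -- The right side is at least `2 * 2² = 8`.
  have hc : (2.8 : ℝ) ≤ 2 * (2 + √((n : ℝ) / m n)) ^ 2 := by
    nlinarith [Real.sqrt_nonneg ((n : ℝ) / m n)]
  have hmid : 2.8 * ‖WithLp.toLp 2 (fun i : Fin n => X i ω) -
      WithLp.toLp 2 (fun i : Fin n => quantize (b n) (X i ω))‖ ≤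
      2 * (2 + √((n : ℝ) / m n)) ^ 2 * (√n * 2 ^ (-(b n : ℝ))) := by gcongr
  rw [div_le_iff₀ hs, add_mul, add_mul, mul_assoc 0.9, div_mul_cancel₀ _ hs.ne']
  linarith
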